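/- Let $G$ be a totally disconnected, locally compact group and let $\alpha\colon G\to G$ be a continuous homomorphism. A sequence in $G$ is called bounded if its set of values has compact closure. An $\alpha$-regressive sequence for $x\in G$ is a sequence $(x_n)_{n\ge 0}$ in $G$ with $x_0=x$ and $\alpha(x_{n+1})=x_n$ for all $n\ge 0$. Define $$\mathrm{par}^+(\alpha)=\{x\in G : (\alpha^n(x))_{n\ge0}\text{ is bounded}\},\qquad \mathrm{par}^-(\alpha)=\{x\in G : x \text{ has a bounded } \alpha\text{-regressive sequence}\}$$ (the parabolic and anti-parabolic subgroups) and $\mathrm{lev}(\alpha)=\mathrm{par}^+(\alpha)\cap\mathrm{par}^-(\alpha)$ (the Levi subgroup). The scale of $\alpha$ is the minimum of the indices $[\alpha(U):\alpha(U)\cap U]$ over all compact open subgroups $U$ of $G$; a compact open subgroup at which the minimum is attained is called minimizing for $\alpha$, and $\mathrm{nub}(\alpha)$ is the intersection of all compact open subgroups of $G$ that are minimizing for $\alpha$. Let $K=\{x\in G : \alpha^n(x)=e\text{ for some }n\ge0\}$ be the iterated kernel, and let the bounded iterated kernel be $$\mathrm{ik}(\alpha)=\overline{K\cap \mathrm{par}^-(\alpha)}.$$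 Then $$\mathrm{ik}(\alpha)\le\mathrm{nub}(\alpha)\le\mathrm{lev}(\alpha),$$ and each of these three subgroups $H$ is $\alpha$-stable, that is, $\alpha(H)=H$. Furthermore, $\mathrm{nub}(\alpha)$ and $\mathrm{ik}(\alpha)$ are compact, $\mathrm{ik}(\alpha)$ is a normal subgroup of $\mathrm{par}^-(\alpha)$, and the endomorphism of the topological group $\mathrm{par}^-(\alpha)/\mathrm{ik}(\alpha)$ induced by $\alpha$ is an automorphism (bijective with continuous inverse). Moreover, the (possibly larger) subgroup $\overline{K}\cap\mathrm{par}^-(\alpha)$, which contains $\mathrm{ik}(\alpha)$, is also contained in $\mathrm{nub}(\alpha)$, is compact, is mapped into itself by $\alpha$, and is normal in $\mathrm{par}^-(\alpha)$. -/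

import Mathlib

namespace Endo

variable {G : Type*} [Group G] [TopologicalSpace G]

/-- A sequence is bounded if its set of values has compact closure. -/
def IsBoundedSeq (u : ℕ → G) : Prop := IsCompact (closure (Set.range u))

/-- `u` is an `α`-regressive sequence for `x`: it starts at `x` and `α (u (n+1)) = u n`. -/
structure IsRegressive (α : G →ₜ* G) (x : G) (u : ℕ → G) : Prop where
  zero : u 0 = x
  succ : ∀ n, α (u (n + 1)) = u n

/-- The displacement index `[α(U) : α(U) ∩ U]` (finite when `U` is compact and open). -/
noncomputable def displacementIndex (α : G →ₜ* G) (U : Subgroup G) : ℕ :=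
  (U.map α.toMonoidHom ⊓ U).relIndex (U.map α.toMonoidHom)

/-- The scale of `α`: the least displacement index of a compact open subgroup. -/
noncomputable def scale (α : G →ₜ* G) : ℕ :=
  sInf {n | ∃ U : Subgroup G,
    IsCompact (U : Set G) ∧ IsOpen (U : Set G) ∧ n = displacementIndex α U}

/-- A compact open subgroup is minimizing if its displacement index is the scale. -/
structure IsMinimizing (α : G →ₜ* G) (U : Subgroup G) : Prop where
  isCompact : IsCompact (U : Set G)
  isOpen : IsOpen (U : Set G)
  index_eq : displacementIndex α U = scale α

/-- The nub: the intersection of all minimizing compact open subgroups. -/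
def nub (α : G →ₜ* G) : Subgroup G := sInf {W | IsMinimizing α W}

/-- A subgroup is `α`-stable if `α` maps it onto itself. -/
def IsStable (α : G →ₜ* G) (H : Subgroup G) : Prop := H.map α.toMonoidHom = H

/-- A subgroup is `α`-invariant if `α` maps it into itself. -/
def IsInvariant (α : G →ₜ* G) (H : Subgroup G) : Prop := H.map α.toMonoidHom ≤ H

lemma iterate_one (α : G →ₜ* G) (n : ℕ) : α^[n] (1 : G) = 1 := iterate_map_one α n

lemma iterate_mul (α : G →ₜ* G) (n : ℕ) (x y : G) : α^[n] (x * y) = α^[n] x * α^[n] y :=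
  iterate_map_mul α n x y

lemma iterate_inv (α : G →ₜ* G) (n : ℕ) (x : G) : α^[n] x⁻¹ = (α^[n] x)⁻¹ :=
  iterate_map_inv α n x

/-- The iterated kernel: the elements that some power of `α` sends to the identity. -/
def iteratedKernel (α : G →ₜ* G) : Subgroup G where
  carrier := {x | ∃ n : ℕ, α^[n] x = 1}
  one_mem' := ⟨0, rfl⟩
  mul_mem' := by
    rintro x y ⟨m, hm⟩ ⟨n, hn⟩
    refine ⟨n + m, ?_⟩
    rw [iterate_mul, Function.iterate_add_apply, hm, iterate_one, Nat.add_comm,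
      Function.iterate_add_apply, hn, iterate_one, one_mul]
  inv_mem' := by
    rintro x ⟨n, hn⟩
    exact ⟨n, by rw [iterate_inv, hn, inv_one]⟩

variable [IsTopologicalGroup G]

lemma IsBoundedSeq.one : IsBoundedSeq (fun _ : ℕ => (1 : G)) := by
  unfold IsBoundedSeq
  rw [Set.range_const]
  exact isCompact_singleton.closure

lemma IsBoundedSeq.mul {u v : ℕ → G} (hu : IsBoundedSeq u) (hv : IsBoundedSeq v) :
    IsBoundedSeq (fun n => u n * v n) := by
  refine (IsCompact.mul hu hv).closure_of_subset ?_
  rintro _ ⟨n, rfl⟩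
  exact Set.mul_mem_mul (subset_closure ⟨n, rfl⟩) (subset_closure ⟨n, rfl⟩)

lemma IsBoundedSeq.inv {u : ℕ → G} (hu : IsBoundedSeq u) : IsBoundedSeq (fun n => (u n)⁻¹) := by
  refine (IsCompact.inv hu).closure_of_subset ?_
  rintro _ ⟨n, rfl⟩
  exact Set.inv_mem_inv.mpr (subset_closure ⟨n, rfl⟩)

/-- The parabolic subgroup: the elements with bounded forward orbit. -/
def parPlus (α : G →ₜ* G) : Subgroup G where
  carrier := {x | IsBoundedSeq (fun n : ℕ => α^[n] x)}
  one_mem' := by simpa only [Set.mem_ofPred_eq, iterate_one] using IsBoundedSeq.one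
  mul_mem' := by
    intro x y hx hy
    simpa only [Set.mem_ofPred_eq, iterate_mul] using IsBoundedSeq.mul hx hy
  inv_mem' := by
    intro x hx
    simpa only [Set.mem_ofPred_eq, iterate_inv] using IsBoundedSeq.inv hx

/-- The anti-parabolic subgroup: the elements with a bounded regressive sequence. -/
def parMinus (α : G →ₜ* G) : Subgroup G where
  carrier := {x | ∃ u : ℕ → G, IsRegressive α x u ∧ IsBoundedSeq u}
  one_mem' := ⟨fun _ => 1, ⟨rfl, fun _ => map_one α⟩, IsBoundedSeq.one⟩
  mul_mem' := by
    rintro x y ⟨u, hu, hub⟩ ⟨v, hv, hvb⟩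
    exact ⟨fun n => u n * v n, ⟨by simp only [hu.zero, hv.zero],
      fun n => by simp only [map_mul, hu.succ, hv.succ]⟩, hub.mul hvb⟩
  inv_mem' := by
    rintro x ⟨u, hu, hub⟩
    exact ⟨fun n => (u n)⁻¹, ⟨by simp only [hu.zero],
      fun n => by simp only [map_inv, hu.succ]⟩, hub.inv⟩

/-- The Levi subgroup. -/
def lev (α : G →ₜ* G) : Subgroup G := parPlus α ⊓ parMinus α

/-- The bounded iterated kernel: the closure of the group of those elements of the iterated
kernel that have a bounded regressive sequence. -/
def ik (α : G →ₜ* G) : Subgroup G := (iteratedKernel α ⊓ parMinus α).topologicalClosure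

lemma map_mem_parMinus (α : G →ₜ* G) {x : G} (hx : x ∈ parMinus α) : α x ∈ parMinus α := by
  obtain ⟨u, hu, hub⟩ := hx
  refine ⟨fun n => α (u n), ⟨by simp only [hu.zero], fun n => by simp only [hu.succ]⟩, ?_⟩
  refine (IsCompact.image hub (map_continuous α)).closure_of_subset ?_
  rintro _ ⟨n, rfl⟩
  exact Set.mem_image_of_mem _ (subset_closure ⟨n, rfl⟩)

/-- The restriction of `α` to its anti-parabolic subgroup. -/
def parMinusHom (α : G →ₜ* G) : parMinus α →* parMinus α :=
  (α.toMonoidHom.comp (parMinus α).subtype).codRestrict (parMinus α)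
    fun x => map_mem_parMinus α x.2

/-- The bounded iterated kernel as a subgroup of the anti-parabolic subgroup. -/
def ikInParMinus (α : G →ₜ* G) : Subgroup (parMinus α) := (ik α).subgroupOf (parMinus α)

end Endo

/-!
Call a compact open subgroup `U` tidy if `U = U₊U₋` and every element of `U` whose orbit is
eventually in `U` has its whole orbit in `U`. Comparing the growth of the indices `[U : U ∩ α⁻ⁿ(U)]`
shows that, as soon as a tidy subgroup exists, the minimizing subgroups are exactly the tidy ones.

For a compact open subgroup `V`, the homoclinic group `V₊₊ ∩ V₋₋` is `α`-stable with compact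
closure `P`. Modulo suitable open normal subgroups of `P` the map `α` is an automorphism of a
finite group, so that all orbits are periodic. It follows that a compact open subgroup containing
`P` becomes tidy on passing to the elements whose orbit stays in it up to a large time. Hence
`nub(α)` is the intersection of the groups `P`. So it is compact and stable, and compact stable
subgroups lie in `lev(α)`.

If `U` is tidy, then `U₋₋` is closed, so it contains the closure of the iterated kernel, while
`par⁻(α) ∩ U₋₋ ≤ U`. This puts the closure of the iterated kernel, intersected with `par⁻(α)`, into
every minimizing subgroup. Finally `U ∩ par⁻(α) = U₊` is a compact neighbourhood of the identity in
`par⁻(α)` with `U₊ ≤ α(U₊)`, which makes `α` open on `par⁻(α)` modulo `ik(α)`.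
-/

open Topology
open scoped Pointwise

namespace Endo

section Index

variable {G : Type*} [Group G] {H K : Subgroup G}

lemma exists_finite_subset_mul_of_relIndex_ne_zero (h0 : H.relIndex K ≠ 0) :
    ∃ F : Set G, F.Finite ∧ F ⊆ K ∧ (K : Set G) ⊆ F * H := by
  have : Finite (K ⧸ H.subgroupOf K) := Nat.finite_of_card_ne_zero h0
  refine ⟨Set.range fun q : K ⧸ H.subgroupOf K => (q.out : G), Set.finite_range _, ?_, ?_⟩
  · rintro _ ⟨q, rfl⟩
    exact q.out.2
  · intro k hk
    let q : K ⧸ H.subgroupOf K := QuotientGroup.mk ⟨k, hk⟩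
    have hq : (q.out : G)⁻¹ * k ∈ H :=
      (QuotientGroup.eq (s := H.subgroupOf K)).mp (QuotientGroup.out_eq' q)
    exact ⟨q.out, ⟨q, rfl⟩, _, hq, mul_inv_cancel_left _ _⟩

lemma relIndex_eq_relIndex_iff_subset_mul {K₁ K₂ : Subgroup G} (hle : K₁ ≤ K₂)
    (h0 : H.relIndex K₂ ≠ 0) :
    H.relIndex K₁ = H.relIndex K₂ ↔ (K₂ : Set G) ⊆ K₁ * H := by
  have : Finite (K₂ ⧸ H.subgroupOf K₂) := Nat.finite_of_card_ne_zero h0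
  let e := Subgroup.quotientSubgroupOfEmbeddingOfLE H hle
  have hcard : H.relIndex K₁ = H.relIndex K₂ ↔ Function.Surjective e :=
    ⟨fun h => (e.injective.bijective_of_nat_card_le h.ge).2,
      fun h => Nat.card_congr (Equiv.ofBijective e ⟨e.injective, h⟩)⟩
  rw [hcard]
  constructor
  · intro hs y hy
    obtain ⟨q, hq⟩ := hs (QuotientGroup.mk ⟨y, hy⟩)
    obtain ⟨x, rfl⟩ := QuotientGroup.mk_surjective q
    rw [Subgroup.quotientSubgroupOfEmbeddingOfLE_apply_mk, QuotientGroup.eq] at hq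
    exact ⟨x, x.2, _, hq, mul_inv_cancel_left _ _⟩
  · intro hs q
    obtain ⟨⟨y, hy⟩, rfl⟩ := QuotientGroup.mk_surjective q
    obtain ⟨x, hx, z, hz, rfl⟩ := hs hy
    refine ⟨QuotientGroup.mk ⟨x, hx⟩, ?_⟩
    rw [Subgroup.quotientSubgroupOfEmbeddingOfLE_apply_mk, QuotientGroup.eq]
    exact Subgroup.mem_subgroupOf.mpr (by simpa using hz)

lemma le_relIndex_of_forall_lt {n : ℕ} (x : Fin n → G) (hx : ∀ i, x i ∈ K)
    (hxH : ∀ i j, i < j → (x i)⁻¹ * x j ∉ H) (h0 : H.relIndex K ≠ 0) : n ≤ H.relIndex K := by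
  have : Finite (K ⧸ H.subgroupOf K) := Nat.finite_of_card_ne_zero h0
  let f : Fin n → K ⧸ H.subgroupOf K := fun i => QuotientGroup.mk ⟨x i, hx i⟩
  have hf : Function.Injective f := .of_lt_imp_ne fun i j hij h =>
    hxH i j hij ((QuotientGroup.eq (s := H.subgroupOf K)).mp h)
  have hcard := Nat.card_le_card_of_injective f hf
  rwa [Nat.card_fin] at hcard

lemma relIndex_comap_le {G' : Type*} [Group G'] (f : G →* G') {U W : Subgroup G}
    {U' W' : Subgroup G'} (hUW : U.relIndex W ≠ 0) (hW' : W'.relIndex U' ≠ 0)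
    (hU : (U'.comap f).relIndex U ≠ 0) :
    (W'.comap f).relIndex W ≤ U.relIndex W * W'.relIndex U' * (U'.comap f).relIndex U := by
  set A := U'.comap f
  set B := W'.comap f
  have hle : (A ⊓ U).map f ≤ U' :=
    (Subgroup.map_mono inf_le_left).trans (Subgroup.map_comap_le f U')
  have hB : B.relIndex (A ⊓ U) ≤ W'.relIndex U' := by
    rw [Subgroup.relIndex_comap]
    exact Subgroup.relIndex_le_of_le_right hle hW'
  have hB0 : B.relIndex (A ⊓ U) ≠ 0 := by
    rw [Subgroup.relIndex_comap]
    exact fun h => hW' (Subgroup.relIndex_eq_zero_of_le_right hle h)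
  have hBA0 : (B ⊓ A).relIndex U ≠ 0 := by
    rw [← Subgroup.relIndex_inf_mul_relIndex]
    exact mul_ne_zero hB0 hU
  have hBAU0 : (B ⊓ A ⊓ U).relIndex W ≠ 0 := by
    rw [← Subgroup.relIndex_inf_mul_relIndex]
    exact mul_ne_zero (fun h => hBA0 (Subgroup.relIndex_eq_zero_of_le_right inf_le_left h)) hUW
  calc B.relIndex W
      ≤ (B ⊓ A ⊓ U).relIndex W :=
        Subgroup.relIndex_le_of_le_left (inf_le_left.trans inf_le_left) hBAU0
    _ = (B ⊓ A).relIndex (U ⊓ W) * U.relIndex W := by rw [Subgroup.relIndex_inf_mul_relIndex]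
    _ ≤ (B ⊓ A).relIndex U * U.relIndex W :=
        Nat.mul_le_mul_right _ (Subgroup.relIndex_le_of_le_right inf_le_left hBA0)
    _ = B.relIndex (A ⊓ U) * A.relIndex U * U.relIndex W := by
        rw [Subgroup.relIndex_inf_mul_relIndex]
    _ ≤ W'.relIndex U' * A.relIndex U * U.relIndex W := by gcongr
    _ = U.relIndex W * W'.relIndex U' * A.relIndex U := by ring

lemma le_of_forall_pow_le_mul_pow {a b C : ℕ} (h : ∀ n, a ^ n ≤ C * b ^ n) : a ≤ b := by
  by_contra! hlt
  rcases b.eq_zero_or_pos with rfl | hb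
  · exact absurd (h 1) (by simpa using hlt.ne')
  have hb' : (0 : ℝ) < b := by exact_mod_cast hb
  obtain ⟨n, hn⟩ := pow_unbounded_of_one_lt (C : ℝ)
    (show (1 : ℝ) < a / b by rw [one_lt_div hb']; exact_mod_cast hlt)
  rw [div_pow, lt_div_iff₀ (pow_pos hb' n)] at hn
  exact absurd (h n) (not_le.mpr (by exact_mod_cast hn))

end Index

section Compact

lemma image_iInter_of_directed_isCompact {X Y ι : Type*} [TopologicalSpace X] [T2Space X]
    [TopologicalSpace Y] [T1Space Y] [Nonempty ι] {f : X → Y} (hf : Continuous f)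
    {K : ι → Set X} (hd : Directed (· ⊇ ·) K) (hK : ∀ i, IsCompact (K i)) :
    f '' ⋂ i, K i = ⋂ i, f '' K i := by
  refine (Set.image_iInter_subset K f).antisymm fun y hy => ?_
  have hfib : ∀ i, IsCompact (K i ∩ f ⁻¹' {y}) := fun i =>
    (hK i).inter_right (isClosed_singleton.preimage hf)
  obtain ⟨x, hx⟩ := IsCompact.nonempty_iInter_of_directed_nonempty_isCompact_isClosed
    (fun i => K i ∩ f ⁻¹' {y})
    (hd.mono_comp _ (g := (· ∩ f ⁻¹' {y})) fun _ _ h => Set.inter_subset_inter_left _ h)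
    (fun i => (Set.mem_iInter.mp hy i).imp fun _ h => ⟨h.1, h.2⟩)
    hfib fun i => (hfib i).isClosed
  rw [Set.mem_iInter] at hx
  exact ⟨x, Set.mem_iInter.mpr fun i => (hx i).1, (hx (Classical.arbitrary ι)).2⟩

variable {G : Type*} [Group G] [TopologicalSpace G] [IsTopologicalGroup G]

lemma relIndex_ne_zero_of_isOpen_of_isCompact {H K : Subgroup G} (hH : IsOpen (H : Set G))
    (hK : IsCompact (K : Set G)) : H.relIndex K ≠ 0 := by
  have : CompactSpace K := isCompact_iff_compactSpace.mp hK
  have := Subgroup.quotient_finite_of_isOpen (H.subgroupOf K) (hH.preimage continuous_subtype_val)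
  exact Subgroup.finiteIndex_iff.mp Subgroup.finiteIndex_of_finite_quotient

lemma isOpen_stabilizer_of_isCompact_of_isOpen {S : Set G} (hc : IsCompact S) (ho : IsOpen S) :
    IsOpen (MulAction.stabilizer G S : Set G) := by
  obtain ⟨V, hV, hVS⟩ := compact_open_separated_mul_left hc ho le_rfl
  have hsub : ∀ g ∈ V, g • S ⊆ S := by
    rintro g hg _ ⟨s, hs, rfl⟩
    exact hVS (Set.mul_mem_mul hg hs)
  refine Subgroup.isOpen_of_mem_nhds _ (g := 1) (Filter.mem_of_superset
    (Filter.inter_mem hV (inv_mem_nhds_one G hV)) ?_)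
  rintro g ⟨hg, hg'⟩
  exact (hsub g hg).antisymm (Set.subset_smul_set_iff.mpr (hsub g⁻¹ hg'))

lemma isCompact_stabilizer_and_stabilizer_subset {S : Set G} (hc : IsCompact S)
    (ho : IsOpen S) (h1 : (1 : G) ∈ S) :
    IsCompact (MulAction.stabilizer G S : Set G) ∧ (MulAction.stabilizer G S : Set G) ⊆ S := by
  have hsub : (MulAction.stabilizer G S : Set G) ⊆ S := fun g (hg : g • S = S) =>
    hg ▸ ⟨1, h1, mul_one g⟩
  exact ⟨hc.of_isClosed_subset (Subgroup.isClosed_of_isOpen _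
    (isOpen_stabilizer_of_isCompact_of_isOpen hc ho)) hsub, hsub⟩

lemma exists_isCompact_isOpen_le_and_subset_mul {L U : Subgroup G} (hL : IsCompact (L : Set G))
    (hU : IsCompact (U : Set G)) (hUo : IsOpen (U : Set G)) :
    ∃ O : Subgroup G, IsCompact (O : Set G) ∧ IsOpen (O : Set G) ∧ L ≤ O ∧
      (O : Set G) ⊆ (L : Set G) * (U : Set G) := by
  have hSc : IsCompact ((L : Set G) * (U : Set G)) := hL.mul hU
  have hSo : IsOpen ((L : Set G) * (U : Set G)) := hUo.mul_left
  obtain ⟨hc, hsub⟩ := isCompact_stabilizer_and_stabilizer_subset hSc hSo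
    ⟨1, L.one_mem, 1, U.one_mem, one_mul 1⟩
  refine ⟨_, hc, isOpen_stabilizer_of_isCompact_of_isOpen hSc hSo, fun l hl => ?_, hsub⟩
  change l • ((L : Set G) * (U : Set G)) = L * U
  rw [← smul_mul_assoc, smul_coe_set hl]

variable [LocallyCompactSpace G] [TotallyDisconnectedSpace G]

/-- Van Dantzig's theorem. -/
lemma exists_isCompact_isOpen_subgroup_subset {N : Set G} (hN : N ∈ 𝓝 (1 : G)) :
    ∃ U : Subgroup G, IsCompact (U : Set G) ∧ IsOpen (U : Set G) ∧ (U : Set G) ⊆ N := by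
  obtain ⟨C, hC, hCN, hCc⟩ := local_compact_nhds hN
  obtain ⟨S, hS, h1S, hSC⟩ := (loc_compact_Haus_tot_disc_of_zero_dim (H := G)).mem_nhds_iff.mp hC
  have hSc : IsCompact S := hCc.of_isClosed_subset hS.1 hSC
  obtain ⟨hc, hsub⟩ := isCompact_stabilizer_and_stabilizer_subset hSc hS.2 h1S
  exact ⟨_, hc, isOpen_stabilizer_of_isCompact_of_isOpen hSc hS.2, hsub.trans (hSC.trans hCN)⟩

lemma mem_of_forall_mem_isCompact_isOpen {L : Subgroup G} (hL : IsCompact (L : Set G)) {x : G}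
    (h : ∀ O : Subgroup G, IsCompact (O : Set G) → IsOpen (O : Set G) → L ≤ O → x ∈ O) :
    x ∈ L := by
  by_contra hx
  have hN : {v | x * v⁻¹ ∉ L} ∈ 𝓝 (1 : G) :=
    (hL.isClosed.isOpen_compl.preimage (by fun_prop : Continuous fun v : G => x * v⁻¹)).mem_nhds
      (by simpa using hx)
  obtain ⟨U, hUc, hUo, hUN⟩ := exists_isCompact_isOpen_subgroup_subset hN
  obtain ⟨O, hOc, hOo, hLO, hOL⟩ := exists_isCompact_isOpen_le_and_subset_mul hL hUc hUo
  obtain ⟨l, hl, v, hv, rfl⟩ := hOL (h O hOc hOo hLO)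
  exact hUN hv (by simpa using hl)

end Compact

section Trajectories

variable {G : Type*} [Group G] [TopologicalSpace G]

/-- The iterates of `α` as group homomorphisms. -/
def iterHom (α : G →ₜ* G) (n : ℕ) : G →* G where
  toFun := α^[n]
  map_one' := iterate_one α n
  map_mul' := iterate_mul α n

/-- The subgroup `U₋ₙ = ⋂_{k ≤ n} α⁻ᵏ(U)` of elements whose orbit stays in `U` up to time `n`. -/
def minusTrunc (α : G →ₜ* G) (U : Subgroup G) (n : ℕ) : Subgroup G where
  carrier := {x | ∀ k ≤ n, α^[k] x ∈ U}
  one_mem' k _ := by rw [iterate_one]; exact U.one_mem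
  mul_mem' hx hy k hk := by rw [iterate_mul]; exact U.mul_mem (hx k hk) (hy k hk)
  inv_mem' hx k hk := by rw [iterate_inv]; exact U.inv_mem (hx k hk)

/-- The subgroup `U₋ = ⋂ₙ U₋ₙ` of elements whose whole forward orbit stays in `U`. -/
def minus (α : G →ₜ* G) (U : Subgroup G) : Subgroup G where
  carrier := {x | ∀ k, α^[k] x ∈ U}
  one_mem' k := by rw [iterate_one]; exact U.one_mem
  mul_mem' hx hy k := by rw [iterate_mul]; exact U.mul_mem (hx k) (hy k)
  inv_mem' hx k := by rw [iterate_inv]; exact U.inv_mem (hx k)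

/-- The subgroup `U₋₋ = ⋃ₙ α⁻ⁿ(U₋)` of elements whose forward orbit is eventually in `U`. -/
def minusMinus (α : G →ₜ* G) (U : Subgroup G) : Subgroup G where
  carrier := {x | ∃ m, ∀ k ≥ m, α^[k] x ∈ U}
  one_mem' := ⟨0, fun k _ => by rw [iterate_one]; exact U.one_mem⟩
  mul_mem' := by
    rintro x y ⟨m, hm⟩ ⟨n, hn⟩
    refine ⟨max m n, fun k hk => ?_⟩
    rw [iterate_mul]
    exact U.mul_mem (hm k (le_of_max_le_left hk)) (hn k (le_of_max_le_right hk))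
  inv_mem' := by
    rintro x ⟨m, hm⟩
    exact ⟨m, fun k hk => by rw [iterate_inv]; exact U.inv_mem (hm k hk)⟩

lemma IsRegressive.one (α : G →ₜ* G) : IsRegressive α 1 (fun _ => 1) :=
  ⟨rfl, fun _ => map_one α⟩

lemma IsRegressive.mul {α : G →ₜ* G} {x y : G} {u v : ℕ → G} (hu : IsRegressive α x u)
    (hv : IsRegressive α y v) : IsRegressive α (x * y) (fun n => u n * v n) :=
  ⟨by simp only [hu.zero, hv.zero], fun n => by simp only [map_mul, hu.succ, hv.succ]⟩

lemma IsRegressive.inv {α : G →ₜ* G} {x : G} {u : ℕ → G} (hu : IsRegressive α x u) :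
    IsRegressive α x⁻¹ (fun n => (u n)⁻¹) :=
  ⟨by simp only [hu.zero], fun n => by simp only [map_inv, hu.succ]⟩

/-- The subgroup `U₊` of elements having a regressive sequence in `U`. -/
def plus (α : G →ₜ* G) (U : Subgroup G) : Subgroup G where
  carrier := {x | ∃ u, IsRegressive α x u ∧ ∀ n, u n ∈ U}
  one_mem' := ⟨_, IsRegressive.one α, fun _ => U.one_mem⟩
  mul_mem' := by
    rintro x y ⟨u, hu, huU⟩ ⟨v, hv, hvU⟩
    exact ⟨_, hu.mul hv, fun n => U.mul_mem (huU n) (hvU n)⟩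
  inv_mem' := by
    rintro x ⟨u, hu, huU⟩
    exact ⟨_, hu.inv, fun n => U.inv_mem (huU n)⟩

/-- The subgroup `U₊₊ = ⋃ₙ αⁿ(U₊)` of elements having a regressive sequence that is eventually
in `U`. -/
def plusPlus (α : G →ₜ* G) (U : Subgroup G) : Subgroup G where
  carrier := {x | ∃ u, IsRegressive α x u ∧ ∃ m, ∀ n ≥ m, u n ∈ U}
  one_mem' := ⟨_, IsRegressive.one α, 0, fun _ _ => U.one_mem⟩
  mul_mem' := by
    rintro x y ⟨u, hu, m, huU⟩ ⟨v, hv, n, hvU⟩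
    exact ⟨_, hu.mul hv, max m n, fun k hk =>
      U.mul_mem (huU k (le_of_max_le_left hk)) (hvU k (le_of_max_le_right hk))⟩
  inv_mem' := by
    rintro x ⟨u, hu, m, huU⟩
    exact ⟨_, hu.inv, m, fun n hn => U.inv_mem (huU n hn)⟩

/-- The subgroup `U₊₊ ∩ U₋₋` of elements lying on a two-sided trajectory that is eventually in `U`
in both directions. Its closure measures how far `U` is from being tidy. -/
def homoclinic (α : G →ₜ* G) (U : Subgroup G) : Subgroup G := plusPlus α U ⊓ minusMinus α U

variable {α : G →ₜ* G} {H K U V : Subgroup G} {x : G} {u : ℕ → G}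

lemma continuous_iterHom (α : G →ₜ* G) (n : ℕ) : Continuous (iterHom α n) :=
  (map_continuous α).iterate n

lemma IsRegressive.iterate (hu : IsRegressive α x u) (m n : ℕ) : α^[n] (u (m + n)) = u m := by
  induction n with
  | zero => rfl
  | succ n ih => rw [Function.iterate_succ_apply, ← Nat.add_assoc, hu.succ, ih]

lemma IsRegressive.iterate_eq (hu : IsRegressive α x u) (n : ℕ) : α^[n] (u n) = x := by
  simpa only [Nat.zero_add, hu.zero] using hu.iterate 0 n

lemma IsRegressive.shift (hu : IsRegressive α x u) (m : ℕ) :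
    IsRegressive α (u m) (fun n => u (m + n)) :=
  ⟨rfl, fun n => hu.succ (m + n)⟩

lemma IsRegressive.cons (hu : IsRegressive α x u) :
    IsRegressive α (α x) (fun n => Nat.casesOn n (α x) u) :=
  ⟨rfl, fun n => by
    cases n with
    | zero => exact congrArg α hu.zero
    | succ n => exact hu.succ n⟩

lemma iterate_mem_iff (h : K.comap α.toMonoidHom = K) (n : ℕ) : α^[n] x ∈ K ↔ x ∈ K := by
  have hα : ∀ y, α y ∈ K ↔ y ∈ K := fun y => SetLike.ext_iff.mp h y
  induction n with
  | zero => rfl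
  | succ n ih => exact Function.iterate_succ_apply' α n x ▸ (hα _).trans ih

lemma IsStable.inf (hH : IsStable α H) (hK : K.comap α.toMonoidHom = K) :
    IsStable α (H ⊓ K) := by
  refine SetLike.coe_injective ?_
  conv_lhs => rw [← hK]
  refine (Set.image_inter_preimage α (H : Set G) (K : Set G)).trans ?_
  rw [show α '' (H : Set G) = H from congrArg SetLike.coe hH, Subgroup.coe_inf]

lemma coe_minusTrunc (n : ℕ) :
    (minusTrunc α U n : Set G) = ⋂ k ∈ Set.Iic n, α^[k] ⁻¹' U := by
  ext x
  simp only [Set.mem_iInter]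
  rfl

lemma minusTrunc_zero : minusTrunc α U 0 = U := by
  ext x
  exact ⟨fun h => h 0 le_rfl, fun h k hk => by rwa [Nat.le_zero.mp hk]⟩

lemma minusTrunc_antitone : Antitone (minusTrunc α U) :=
  fun _ _ hmn _ hx k hk => hx k (hk.trans hmn)

lemma minusTrunc_le (n : ℕ) : minusTrunc α U n ≤ U := fun _ hx => hx 0 (Nat.zero_le _)

lemma minusTrunc_le_comap_iterHom (n : ℕ) : minusTrunc α U n ≤ U.comap (iterHom α n) :=
  fun _ hx => hx n le_rfl

lemma minusTrunc_add (m n : ℕ) :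
    minusTrunc α U (m + n) = (minusTrunc α U n).comap (iterHom α m) ⊓ minusTrunc α U m := by
  ext x
  constructor
  · refine fun h => ⟨fun k hk => ?_, fun k hk => h k (by omega)⟩
    exact (Function.iterate_add_apply α k m x) ▸ h _ (by omega)
  · rintro ⟨h₁, h₂⟩ k hk
    rcases le_total k m with h | h
    · exact h₂ k h
    · obtain ⟨k, rfl⟩ := Nat.exists_eq_add_of_le' h
      exact (Function.iterate_add_apply α k m x).symm ▸ h₁ k (by omega)

lemma minusTrunc_minusTrunc (m n : ℕ) :
    minusTrunc α (minusTrunc α U m) n = minusTrunc α U (m + n) := by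
  ext x
  constructor
  · intro h k hk
    have := h (k - m) (by omega) (min k m) (min_le_right _ _)
    rwa [← Function.iterate_add_apply, show min k m + (k - m) = k by omega] at this
  · intro h k hk j hj
    exact (Function.iterate_add_apply α j k x) ▸ h _ (by omega)

lemma map_iterHom_minusTrunc_antitone :
    Antitone fun n => (minusTrunc α U n).map (iterHom α n) := by
  refine antitone_nat_of_succ_le fun n => ?_
  rintro _ ⟨x, hx, rfl⟩
  exact ⟨α x, fun k hk => hx (k + 1) (by omega), rfl⟩

lemma map_iterHom_minusTrunc_le (n : ℕ) : (minusTrunc α U n).map (iterHom α n) ≤ U :=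
  Subgroup.map_le_iff_le_comap.mpr (minusTrunc_le_comap_iterHom n)

lemma minus_eq_iInf_minusTrunc : minus α U = ⨅ n, minusTrunc α U n := by
  ext x
  rw [Subgroup.mem_iInf]
  exact ⟨fun hx n k _ => hx k, fun hx k => hx k k le_rfl⟩

lemma minus_le_minusTrunc (n : ℕ) : minus α U ≤ minusTrunc α U n := fun _ hx k _ => hx k

lemma minus_le : minus α U ≤ U := fun _ hx => hx 0

lemma minus_le_minusMinus : minus α U ≤ minusMinus α U := fun _ hx => ⟨0, fun k _ => hx k⟩

lemma iterate_mem_minus_of_forall_ge {n : ℕ} (h : ∀ k ≥ n, α^[k] x ∈ U) : α^[n] x ∈ minus α U :=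
  fun k => (Function.iterate_add_apply α k n x) ▸ h (k + n) (Nat.le_add_left n k)

lemma le_minus_of_map_le (hHα : H.map α.toMonoidHom ≤ H) (hHU : H ≤ U) : H ≤ minus α U :=
  fun _ hx k => hHU (Set.MapsTo.iterate (s := (H : Set G))
    (fun _ hy => hHα (Subgroup.mem_map_of_mem _ hy)) k hx)

lemma comap_minusMinus : (minusMinus α U).comap α.toMonoidHom = minusMinus α U := by
  ext x
  constructor
  · rintro ⟨m, hm⟩
    refine ⟨m + 1, fun k hk => ?_⟩
    obtain ⟨k, rfl⟩ := Nat.exists_eq_add_of_le' (Nat.le_of_add_left_le hk)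
    exact hm k (by omega)
  · rintro ⟨m, hm⟩
    exact ⟨m, fun k hk => hm (k + 1) (by omega)⟩

lemma plus_le : plus α U ≤ U := by
  rintro x ⟨u, hu, huU⟩
  exact hu.zero ▸ huU 0

lemma plus_le_plusPlus : plus α U ≤ plusPlus α U := by
  rintro x ⟨u, hu, huU⟩
  exact ⟨u, hu, 0, fun n _ => huU n⟩

lemma le_plus_of_le_map (hHα : H ≤ H.map α.toMonoidHom) (hHU : H ≤ U) : H ≤ plus α U := by
  intro x hx
  choose s hsH hs using fun y : H => hHα y.2
  refine ⟨fun n => ((fun y : H => (⟨s y, hsH y⟩ : H))^[n] ⟨x, hx⟩ : H), ⟨rfl, fun n => ?_⟩,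
    fun n => hHU (SetLike.coe_mem _)⟩
  rw [Function.iterate_succ_apply']
  exact hs _

lemma plus_le_map_plus : plus α U ≤ (plus α U).map α.toMonoidHom := by
  rintro x ⟨u, hu, huU⟩
  exact ⟨u 1, ⟨_, hu.shift 1, fun n => huU _⟩, (hu.succ 0).trans hu.zero⟩

lemma map_plus_inf_le : (plus α U).map α.toMonoidHom ⊓ U ≤ plus α U := by
  rintro _ ⟨⟨x, ⟨u, hu, huU⟩, rfl⟩, hxU⟩
  refine ⟨_, hu.cons, fun n => ?_⟩
  cases n with
  | zero => exact hxU
  | succ n => exact huU n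

lemma exists_mem_plus_minusTrunc_iterate_eq (hx : x ∈ plus α U) (n : ℕ) :
    ∃ y ∈ plus α U, y ∈ minusTrunc α U n ∧ α^[n] y = x := by
  obtain ⟨u, hu, huU⟩ := hx
  refine ⟨u n, ⟨_, hu.shift n, fun k => huU _⟩, fun k hk => ?_, hu.iterate_eq n⟩
  obtain ⟨j, rfl⟩ := Nat.exists_eq_add_of_le' hk
  exact (hu.iterate j k).symm ▸ huU j

lemma plus_le_map_iterHom_minusTrunc (n : ℕ) :
    plus α U ≤ (minusTrunc α U n).map (iterHom α n) := fun _ hx =>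
  let ⟨y, _, hy, hyx⟩ := exists_mem_plus_minusTrunc_iterate_eq hx n
  ⟨y, hy, hyx⟩

lemma isStable_plusPlus : IsStable α (plusPlus α U) := by
  apply le_antisymm
  · rintro _ ⟨x, ⟨u, hu, m, hm⟩, rfl⟩
    refine ⟨_, hu.cons, m + 1, fun n hn => ?_⟩
    obtain ⟨n, rfl⟩ := Nat.exists_eq_add_of_le' (Nat.le_of_add_left_le hn)
    exact hm n (by omega)
  · rintro x ⟨u, hu, m, hm⟩
    exact ⟨u 1, ⟨_, hu.shift 1, m, fun n hn => hm _ (by omega)⟩, (hu.succ 0).trans hu.zero⟩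

lemma minusMinus_mono (h : U ≤ V) : minusMinus α U ≤ minusMinus α V :=
  fun _ ⟨m, hm⟩ => ⟨m, fun k hk => h (hm k hk)⟩

lemma plusPlus_mono (h : U ≤ V) : plusPlus α U ≤ plusPlus α V :=
  fun _ ⟨u, hu, m, hm⟩ => ⟨u, hu, m, fun k hk => h (hm k hk)⟩

lemma homoclinic_mono (h : U ≤ V) : homoclinic α U ≤ homoclinic α V :=
  inf_le_inf (plusPlus_mono h) (minusMinus_mono h)

lemma isStable_homoclinic : IsStable α (homoclinic α U) :=
  isStable_plusPlus.inf comap_minusMinus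

lemma isOpen_minusTrunc (ho : IsOpen (U : Set G)) (n : ℕ) : IsOpen (minusTrunc α U n : Set G) := by
  rw [coe_minusTrunc]
  exact (Set.finite_Iic n).isOpen_biInter fun k _ => ho.preimage (continuous_iterHom α k)

lemma isClosed_minusTrunc (hc : IsClosed (U : Set G)) (n : ℕ) :
    IsClosed (minusTrunc α U n : Set G) := by
  rw [coe_minusTrunc]
  exact isClosed_biInter fun k _ => hc.preimage (continuous_iterHom α k)

lemma isClosed_minus (hc : IsClosed (U : Set G)) : IsClosed (minus α U : Set G) := by
  rw [minus_eq_iInf_minusTrunc, Subgroup.coe_iInf]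
  exact isClosed_iInter (isClosed_minusTrunc hc)

lemma isCompact_minusTrunc [T2Space G] (hc : IsCompact (U : Set G)) (n : ℕ) :
    IsCompact (minusTrunc α U n : Set G) :=
  hc.of_isClosed_subset (isClosed_minusTrunc hc.isClosed n) (minusTrunc_le n)

lemma plus_eq_iInf_map_iterHom_minusTrunc [T2Space G] (hc : IsCompact (U : Set G)) :
    plus α U = ⨅ n, (minusTrunc α U n).map (iterHom α n) := by
  refine le_antisymm (le_iInf plus_le_map_iterHom_minusTrunc) (le_plus_of_le_map ?_
    ((iInf_le _ 0).trans (map_iterHom_minusTrunc_le 0)))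
  set A : ℕ → Subgroup G := fun n => (minusTrunc α U n).map (iterHom α n)
  have hsucc : ∀ n, A (n + 1) ≤ (A n).map α.toMonoidHom := by
    rintro n _ ⟨x, hx, rfl⟩
    exact ⟨_, ⟨x, minusTrunc_antitone n.le_succ hx, rfl⟩, (Function.iterate_succ_apply' α n x).symm⟩
  have himage : α '' ⋂ n, (A n : Set G) = ⋂ n, α '' (A n : Set G) :=
    image_iInter_of_directed_isCompact (map_continuous α)
      (Antitone.directed_ge fun _ _ hmn => map_iterHom_minusTrunc_antitone hmn)
      fun n => (isCompact_minusTrunc hc n).image (continuous_iterHom α n)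
  intro x hx
  suffices x ∈ α '' ⋂ n, (A n : Set G) by rwa [← Subgroup.coe_iInf] at this
  rw [himage, Set.mem_iInter]
  exact fun n => hsucc n (Subgroup.mem_iInf.mp hx (n + 1))

lemma isCompact_plus [T2Space G] (hc : IsCompact (U : Set G)) : IsCompact (plus α U : Set G) := by
  rw [plus_eq_iInf_map_iterHom_minusTrunc hc, Subgroup.coe_iInf]
  have hA : ∀ n, IsCompact ((minusTrunc α U n).map (iterHom α n) : Set G) := fun n =>
    (isCompact_minusTrunc hc n).image (continuous_iterHom α n)
  exact (hA 0).of_isClosed_subset (isClosed_iInter fun n => (hA n).isClosed) (Set.iInter_subset _ 0)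

end Trajectories

section TidyAbove

variable {G : Type*} [Group G] [TopologicalSpace G] {α : G →ₜ* G} {U : Subgroup G} {x : G}

/-- A subgroup is tidy above if it factorizes as `U = U₊U₋`. -/
def IsTidyAbove (α : G →ₜ* G) (U : Subgroup G) : Prop :=
  (U : Set G) ⊆ (plus α U : Set G) * (minus α U : Set G)

lemma displacementIndex_eq_relIndex_minusTrunc_one (α : G →ₜ* G) (U : Subgroup G) :
    displacementIndex α U = (minusTrunc α U 1).relIndex U := by
  have h1 : minusTrunc α U 1 = U.comap α.toMonoidHom ⊓ U := by
    ext x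
    refine ⟨fun h => ⟨h 1 le_rfl, h 0 (Nat.zero_le 1)⟩, fun ⟨h₁, h₀⟩ k hk => ?_⟩
    interval_cases k
    exacts [h₀, h₁]
  rw [displacementIndex, inf_comm, Subgroup.inf_relIndex_right, h1, Subgroup.inf_relIndex_right,
    Subgroup.relIndex_comap]

lemma displacementIndex_minusTrunc (α : G →ₜ* G) (U : Subgroup G) (n : ℕ) :
    displacementIndex α (minusTrunc α U n) =
      (minusTrunc α U (n + 1)).relIndex (minusTrunc α U n) := by
  rw [displacementIndex_eq_relIndex_minusTrunc_one, minusTrunc_minusTrunc]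

lemma relIndex_minusTrunc_add_eq_relIndex_map (m n : ℕ) :
    (minusTrunc α U (m + n)).relIndex (minusTrunc α U m) =
      (minusTrunc α U n).relIndex ((minusTrunc α U m).map (iterHom α m)) := by
  rw [minusTrunc_add, Subgroup.inf_relIndex_right, Subgroup.relIndex_comap]

lemma relIndex_minusTrunc_add_eq_prod (m n : ℕ) :
    (minusTrunc α U (m + n)).relIndex (minusTrunc α U m) =
      ∏ i ∈ Finset.range n, displacementIndex α (minusTrunc α U (m + i)) := by
  induction n with
  | zero => exact Subgroup.relIndex_self _
  | succ n ih =>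
    rw [Finset.prod_range_succ, ← ih, displacementIndex_minusTrunc, mul_comm, ← Nat.add_assoc]
    exact (Subgroup.relIndex_mul_relIndex _ _ _ (minusTrunc_antitone (Nat.le_succ _))
      (minusTrunc_antitone (Nat.le_add_right m n))).symm

lemma relIndex_minusTrunc_eq_prod (n : ℕ) :
    (minusTrunc α U n).relIndex U =
      ∏ i ∈ Finset.range n, displacementIndex α (minusTrunc α U i) := by
  simpa only [Nat.zero_add, minusTrunc_zero] using relIndex_minusTrunc_add_eq_prod (U := U) 0 n

lemma IsTidyAbove.exists_mul_eq (h : IsTidyAbove α U) (hx : x ∈ U) :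
    ∃ z ∈ plus α U, ∃ v ∈ minus α U, z * v = x := h hx

variable [IsTopologicalGroup G]

lemma relIndex_minusTrunc_ne_zero (hc : IsCompact (U : Set G)) (ho : IsOpen (U : Set G)) (n : ℕ) :
    (minusTrunc α U n).relIndex U ≠ 0 :=
  relIndex_ne_zero_of_isOpen_of_isCompact (isOpen_minusTrunc ho n) hc

lemma displacementIndex_minusTrunc_antitone (hc : IsCompact (U : Set G))
    (ho : IsOpen (U : Set G)) : Antitone fun n => displacementIndex α (minusTrunc α U n) := by
  intro m n hmn
  simp only [displacementIndex_minusTrunc, relIndex_minusTrunc_add_eq_relIndex_map]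
  refine Subgroup.relIndex_le_of_le_right (map_iterHom_minusTrunc_antitone hmn) fun h0 => ?_
  exact relIndex_minusTrunc_ne_zero hc ho 1
    (Subgroup.relIndex_eq_zero_of_le_right (map_iterHom_minusTrunc_le m) h0)

lemma displacementIndex_minusTrunc_le (hc : IsCompact (U : Set G)) (ho : IsOpen (U : Set G))
    (n : ℕ) : displacementIndex α (minusTrunc α U n) ≤ displacementIndex α U := by
  simpa only [minusTrunc_zero] using
    displacementIndex_minusTrunc_antitone (α := α) hc ho (Nat.zero_le n)

lemma relIndex_minusTrunc_le_pow (hc : IsCompact (U : Set G)) (ho : IsOpen (U : Set G)) (n : ℕ) :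
    (minusTrunc α U n).relIndex U ≤ displacementIndex α U ^ n := by
  rw [relIndex_minusTrunc_eq_prod]
  simpa only [Finset.card_range] using Finset.prod_le_pow_card (Finset.range n) _ _
    fun i _ => displacementIndex_minusTrunc_le hc ho i

lemma IsTidyAbove.displacementIndex_minusTrunc_eq (h : IsTidyAbove α U)
    (hc : IsCompact (U : Set G)) (ho : IsOpen (U : Set G)) (n : ℕ) :
    displacementIndex α (minusTrunc α U n) = displacementIndex α U := by
  rw [displacementIndex_minusTrunc, relIndex_minusTrunc_add_eq_relIndex_map,
    displacementIndex_eq_relIndex_minusTrunc_one, relIndex_eq_relIndex_iff_subset_mul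
    (map_iterHom_minusTrunc_le n) (relIndex_minusTrunc_ne_zero hc ho 1)]
  exact h.trans (Set.mul_subset_mul (plus_le_map_iterHom_minusTrunc n) (minus_le_minusTrunc 1))

lemma isTidyAbove_of_forall_subset_mul [T2Space G] (hc : IsCompact (U : Set G))
    (h : ∀ n, (U : Set G) ⊆ (minusTrunc α U n).map (iterHom α n) * minusTrunc α U n) :
    IsTidyAbove α U := by
  let A : ℕ → Set G := fun n => (minusTrunc α U n).map (iterHom α n)
  let B : ℕ → Set G := fun n => minusTrunc α U n
  have hAB : Antitone fun n => A n ×ˢ B n := fun m n hmn =>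
    Set.prod_mono (map_iterHom_minusTrunc_antitone hmn) (minusTrunc_antitone hmn)
  have himage : (fun p : G × G => p.1 * p.2) '' ⋂ n, A n ×ˢ B n = ⋂ n, A n * B n := by
    simp only [← Set.image_mul_prod]
    exact image_iInter_of_directed_isCompact continuous_mul hAB.directed_ge fun n =>
      ((isCompact_minusTrunc hc n).image (continuous_iterHom α n)).prod (isCompact_minusTrunc hc n)
  intro x hx
  obtain ⟨⟨z, v⟩, hzv, rfl⟩ := himage.ge (Set.mem_iInter.mpr fun n => h n hx)
  rw [Set.mem_iInter] at hzv
  refine ⟨z, ?_, v, ?_, rfl⟩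
  · rw [plus_eq_iInf_map_iterHom_minusTrunc hc]
    exact Subgroup.mem_iInf.mpr fun n => (hzv n).1
  · rw [minus_eq_iInf_minusTrunc]
    exact Subgroup.mem_iInf.mpr fun n => (hzv n).2

lemma isTidyAbove_iff_displacementIndex_minusTrunc_eq [T2Space G] (hc : IsCompact (U : Set G))
    (ho : IsOpen (U : Set G)) :
    IsTidyAbove α U ↔ ∀ n, displacementIndex α (minusTrunc α U n) = displacementIndex α U := by
  refine ⟨fun h n => h.displacementIndex_minusTrunc_eq hc ho n, fun h => ?_⟩
  refine isTidyAbove_of_forall_subset_mul hc fun n => ?_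
  rw [← relIndex_eq_relIndex_iff_subset_mul (map_iterHom_minusTrunc_le n)
    (relIndex_minusTrunc_ne_zero hc ho n), ← relIndex_minusTrunc_add_eq_relIndex_map,
    relIndex_minusTrunc_add_eq_prod, relIndex_minusTrunc_eq_prod]
  simp only [h]

lemma IsTidyAbove.relIndex_minusTrunc (h : IsTidyAbove α U) (hc : IsCompact (U : Set G))
    (ho : IsOpen (U : Set G)) (n : ℕ) :
    (minusTrunc α U n).relIndex U = displacementIndex α U ^ n := by
  simp only [relIndex_minusTrunc_eq_prod, h.displacementIndex_minusTrunc_eq hc ho,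
    Finset.prod_const, Finset.card_range]

lemma exists_isTidyAbove_minusTrunc [T2Space G] (hc : IsCompact (U : Set G))
    (ho : IsOpen (U : Set G)) : ∃ n, IsTidyAbove α (minusTrunc α U n) := by
  obtain ⟨n, hn⟩ := WellFoundedLT.antitone_chain_condition
    (displacementIndex_minusTrunc_antitone (α := α) hc ho)
  refine ⟨n, (isTidyAbove_iff_displacementIndex_minusTrunc_eq (isCompact_minusTrunc hc n)
    (isOpen_minusTrunc ho n)).mpr fun m => ?_⟩
  rw [minusTrunc_minusTrunc]
  exact (hn (n + m) (Nat.le_add_right n m)).symm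

end TidyAbove

section Homoclinic

variable {G : Type*} [Group G] [TopologicalSpace G] {α : G →ₜ* G} {H U : Subgroup G} {x : G}

lemma exists_iterate_mem_minus_of_finite {F : Set G} (hF : F.Finite)
    (hFU : F ⊆ minusMinus α U) : ∃ N, ∀ f ∈ F, α^[N] f ∈ minus α U := by
  choose! m hm using hFU
  obtain ⟨N, hN⟩ := (hF.image m).bddAbove
  exact ⟨N, fun f hf => iterate_mem_minus_of_forall_ge fun k hk =>
    hm hf k ((hN ⟨f, hf, rfl⟩).trans hk)⟩

lemma le_map_plus_inf_minusMinus :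
    plus α U ⊓ minusMinus α U ≤ (plus α U ⊓ minusMinus α U).map α.toMonoidHom := by
  rintro x ⟨hx, hx'⟩
  obtain ⟨y, hy, rfl⟩ := plus_le_map_plus hx
  exact ⟨y, ⟨hy, comap_minusMinus.le hx'⟩, rfl⟩

lemma map_plus_inf_minusMinus_inf_le :
    (plus α U ⊓ minusMinus α U).map α.toMonoidHom ⊓ U ≤ plus α U ⊓ minusMinus α U := by
  rintro _ ⟨⟨w, hw, rfl⟩, hwU⟩
  exact ⟨map_plus_inf_le ⟨⟨w, hw.1, rfl⟩, hwU⟩, comap_minusMinus.ge hw.2⟩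

lemma map_iterHom_monotone (h : H ≤ H.map α.toMonoidHom) :
    Monotone fun n => H.map (iterHom α n) := by
  refine monotone_nat_of_le_succ fun n => ?_
  rintro _ ⟨w, hw, rfl⟩
  obtain ⟨y, hy, rfl⟩ := h hw
  exact ⟨y, hy, rfl⟩

lemma exists_mem_map_iterHom_of_mem_homoclinic (hx : x ∈ homoclinic α U) :
    ∃ n, x ∈ (plus α U ⊓ minusMinus α U).map (iterHom α n) := by
  obtain ⟨⟨u, hu, m, hm⟩, hx'⟩ := hx
  rw [← hu.iterate_eq m] at hx'
  exact ⟨m, u m, ⟨⟨_, hu.shift m, fun n => hm _ (Nat.le_add_right m n)⟩,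
    (iterate_mem_iff comap_minusMinus m).mp hx'⟩, hu.iterate_eq m⟩

variable [IsTopologicalGroup G]

lemma exists_finite_subset_mul_map_plus_inf_minusMinus (hc : IsCompact (U : Set G))
    (ho : IsOpen (U : Set G)) : ∃ F : Set G, F.Finite ∧ F ⊆ minusMinus α U ∧
      ((plus α U ⊓ minusMinus α U).map α.toMonoidHom : Set G) ⊆
        F * (plus α U ⊓ minusMinus α U : Subgroup G) := by
  set W := plus α U ⊓ minusMinus α U
  have h0 : U.relIndex (W.map α.toMonoidHom) ≠ 0 := fun h =>
    relIndex_ne_zero_of_isOpen_of_isCompact (K := U.map α.toMonoidHom) ho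
      (hc.image (map_continuous α)) (Subgroup.relIndex_eq_zero_of_le_right
        (Subgroup.map_mono (inf_le_left.trans plus_le)) h)
  obtain ⟨F, hF, hFW, hWF⟩ := exists_finite_subset_mul_of_relIndex_ne_zero h0
  refine ⟨F, hF, fun f hf => ?_, fun y hy => ?_⟩
  · obtain ⟨w, hw, rfl⟩ := hFW hf
    exact comap_minusMinus.ge hw.2
  · obtain ⟨f, hf, v, hv, rfl⟩ := hWF hy
    have hv' : v ∈ W.map α.toMonoidHom := (Subgroup.mul_mem_cancel_left _ (hFW hf)).mp hy
    exact ⟨f, hf, v, map_plus_inf_minusMinus_inf_le ⟨hv', hv⟩, rfl⟩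

lemma exists_map_iterHom_add_subset_mul (hc : IsCompact (U : Set G)) (ho : IsOpen (U : Set G)) :
    ∃ N, ∀ n, ((plus α U ⊓ minusMinus α U).map (iterHom α (N + n)) : Set G) ⊆
      minus α U * (plus α U ⊓ minusMinus α U).map (iterHom α N) := by
  set W := plus α U ⊓ minusMinus α U
  obtain ⟨F, hF, hFU, hWF⟩ :=
    exists_finite_subset_mul_map_plus_inf_minusMinus (α := α) hc ho
  obtain ⟨N, hN⟩ := exists_iterate_mem_minus_of_finite hF hFU
  refine ⟨N, fun n => ?_⟩
  induction n with
  | zero => exact fun y hy => ⟨1, one_mem _, y, hy, one_mul y⟩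
  | succ n ih =>
    rintro _ ⟨w, hw, rfl⟩
    obtain ⟨f, hf, w', hw', hfw⟩ := hWF ⟨w, hw, rfl⟩
    obtain ⟨v, hv, z, hz, hvz⟩ := ih ⟨w', hw', rfl⟩
    have hfU : iterHom α (N + n) f ∈ minus α U := fun k => by
      change α^[k] (α^[N + n] f) ∈ U
      rw [Nat.add_comm, Function.iterate_add_apply, ← Function.iterate_add_apply]
      exact hN f hf _
    refine ⟨iterHom α (N + n) f * v, mul_mem hfU hv, z, hz, ?_⟩
    calc iterHom α (N + n) f * v * z = iterHom α (N + n) (f * w') := by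
          rw [mul_assoc, map_mul, ← hvz]
      _ = iterHom α (N + (n + 1)) w := congrArg (iterHom α (N + n)) hfw

lemma exists_homoclinic_subset_mul (hc : IsCompact (U : Set G)) (ho : IsOpen (U : Set G)) :
    ∃ N, (homoclinic α U : Set G) ⊆ U * iterHom α N '' U := by
  obtain ⟨N, hN⟩ := exists_map_iterHom_add_subset_mul (α := α) hc ho
  refine ⟨N, fun x hx => ?_⟩
  obtain ⟨n, hn⟩ := exists_mem_map_iterHom_of_mem_homoclinic hx
  exact Set.mul_subset_mul minus_le (Set.image_mono (inf_le_left.trans plus_le))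
    (hN n (map_iterHom_monotone le_map_plus_inf_minusMinus (Nat.le_add_left n N) hn))

lemma isCompact_topologicalClosure_homoclinic [T2Space G] (hc : IsCompact (U : Set G))
    (ho : IsOpen (U : Set G)) : IsCompact ((homoclinic α U).topologicalClosure : Set G) := by
  obtain ⟨N, hN⟩ := exists_homoclinic_subset_mul (α := α) hc ho
  exact (hc.mul (hc.image (continuous_iterHom α N))).closure_of_subset hN

lemma map_topologicalClosure_le (h : H.map α.toMonoidHom ≤ H) :
    H.topologicalClosure.map α.toMonoidHom ≤ H.topologicalClosure := by
  rw [Subgroup.map_le_iff_le_comap] at h ⊢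
  exact H.topologicalClosure_minimal (h.trans (Subgroup.comap_mono H.le_topologicalClosure))
    (H.isClosed_topologicalClosure.preimage (map_continuous α))

lemma IsStable.topologicalClosure [T2Space G] (h : IsStable α H)
    (hc : IsCompact (H.topologicalClosure : Set G)) : IsStable α H.topologicalClosure :=
  (map_topologicalClosure_le h.le).antisymm (H.topologicalClosure_minimal
    (h.ge.trans (Subgroup.map_mono H.le_topologicalClosure))
    (hc.image (map_continuous α)).isClosed)

end Homoclinic

section Scale

variable {G : Type*} [Group G] [TopologicalSpace G] {α : G →ₜ* G} {U W : Subgroup G} {x : G}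

/-- A compact open subgroup is tidy if it is tidy above and each of its elements whose orbit is
eventually in it has its whole orbit in it. The second condition is a form of being tidy below that
does not involve closed subgroups. -/
structure IsTidy (α : G →ₜ* G) (U : Subgroup G) : Prop where
  isCompact : IsCompact (U : Set G)
  isOpen : IsOpen (U : Set G)
  isTidyAbove : IsTidyAbove α U
  inf_minusMinus_le : U ⊓ minusMinus α U ≤ minus α U

lemma IsTidyAbove.inf_minusMinus_le (h : IsTidyAbove α U)
    (hU : plus α U ⊓ minusMinus α U ≤ minus α U) : U ⊓ minusMinus α U ≤ minus α U := by
  rintro x ⟨hx, hx'⟩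
  obtain ⟨z, hz, v, hv, rfl⟩ := h.exists_mul_eq hx
  have hz' : z ∈ minusMinus α U :=
    (Subgroup.mul_mem_cancel_right _ (minus_le_minusMinus hv)).mp hx'
  exact mul_mem (hU ⟨hz, hz'⟩) hv

lemma scale_le_displacementIndex (hc : IsCompact (U : Set G)) (ho : IsOpen (U : Set G)) :
    scale α ≤ displacementIndex α U :=
  Nat.sInf_le ⟨U, hc, ho, rfl⟩

lemma isMinimizing_of_forall_le (hc : IsCompact (U : Set G)) (ho : IsOpen (U : Set G))
    (h : ∀ V : Subgroup G, IsCompact (V : Set G) → IsOpen (V : Set G) →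
      displacementIndex α U ≤ displacementIndex α V) : IsMinimizing α U := by
  refine ⟨hc, ho, le_antisymm (le_csInf ⟨_, U, hc, ho, rfl⟩ ?_) (scale_le_displacementIndex hc ho)⟩
  rintro _ ⟨V, hVc, hVo, rfl⟩
  exact h V hVc hVo

lemma IsTidy.minusTrunc_eq_comap_inf (h : IsTidy α U) (n : ℕ) :
    minusTrunc α U n = U.comap (iterHom α n) ⊓ U := by
  refine le_antisymm (le_inf (minusTrunc_le_comap_iterHom n) (minusTrunc_le n)) ?_
  rintro x ⟨hxn, hx⟩
  obtain ⟨_, hy, v, hv, hyv⟩ := h.isTidyAbove.exists_mul_eq hxn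
  obtain ⟨z, hz, hzn, rfl⟩ := exists_mem_plus_minusTrunc_iterate_eq hy n
  have hzx : α^[n] (z⁻¹ * x) = v := by
    rw [iterate_mul, iterate_inv]
    exact inv_mul_eq_of_eq_mul hyv.symm
  have hzx' : z⁻¹ * x ∈ minus α U := h.inf_minusMinus_le
    ⟨U.mul_mem (U.inv_mem (plus_le hz)) hx,
      (iterate_mem_iff comap_minusMinus n).mp (hzx ▸ minus_le_minusMinus hv)⟩
  simpa only [mul_inv_cancel_left] using mul_mem hzn (minus_le_minusTrunc n hzx')

variable [IsTopologicalGroup G]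

lemma relIndex_comap_iterHom_ne_zero (hU : IsOpen (U : Set G)) (hW : IsCompact (W : Set G))
    (n : ℕ) : (U.comap (iterHom α n)).relIndex W ≠ 0 :=
  relIndex_ne_zero_of_isOpen_of_isCompact (hU.preimage (continuous_iterHom α n)) hW

lemma relIndex_comap_iterHom_le (hU : IsCompact (U : Set G)) (hUo : IsOpen (U : Set G))
    (hW : IsCompact (W : Set G)) (hWo : IsOpen (W : Set G)) (n : ℕ) :
    (W.comap (iterHom α n)).relIndex W ≤
      U.relIndex W * W.relIndex U * (U.comap (iterHom α n)).relIndex U :=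
  relIndex_comap_le _ (relIndex_ne_zero_of_isOpen_of_isCompact hUo hW)
    (relIndex_ne_zero_of_isOpen_of_isCompact hWo hU) (relIndex_comap_iterHom_ne_zero hUo hU n)

lemma IsTidy.relIndex_comap_iterHom (h : IsTidy α U) (n : ℕ) :
    (U.comap (iterHom α n)).relIndex U = displacementIndex α U ^ n := by
  rw [← h.isTidyAbove.relIndex_minusTrunc h.isCompact h.isOpen, h.minusTrunc_eq_comap_inf,
    Subgroup.inf_relIndex_right]

lemma IsTidy.isMinimizing (h : IsTidy α W) : IsMinimizing α W := by
  refine isMinimizing_of_forall_le h.isCompact h.isOpen fun U hc ho => ?_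
  refine le_of_forall_pow_le_mul_pow (C := U.relIndex W * W.relIndex U) fun n => ?_
  calc displacementIndex α W ^ n
      = (W.comap (iterHom α n)).relIndex W := (h.relIndex_comap_iterHom n).symm
    _ ≤ U.relIndex W * W.relIndex U * (U.comap (iterHom α n)).relIndex U :=
        relIndex_comap_iterHom_le hc ho h.isCompact h.isOpen n
    _ ≤ U.relIndex W * W.relIndex U * (minusTrunc α U n).relIndex U :=
        Nat.mul_le_mul_left _ (Subgroup.relIndex_le_of_le_left (minusTrunc_le_comap_iterHom n)
          (relIndex_minusTrunc_ne_zero hc ho n))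
    _ ≤ U.relIndex W * W.relIndex U * displacementIndex α U ^ n :=
        Nat.mul_le_mul_left _ (relIndex_minusTrunc_le_pow hc ho n)

lemma IsMinimizing.isMinimizing_minusTrunc (h : IsMinimizing α U) (n : ℕ) :
    IsMinimizing α (minusTrunc α U n) := by
  have ho := isOpen_minusTrunc (α := α) h.isOpen n
  have hc : IsCompact (minusTrunc α U n : Set G) :=
    h.isCompact.of_isClosed_subset (Subgroup.isClosed_of_isOpen _ ho) (minusTrunc_le n)
  refine ⟨hc, ho, le_antisymm ?_ (scale_le_displacementIndex hc ho)⟩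
  exact h.index_eq ▸ displacementIndex_minusTrunc_le h.isCompact h.isOpen n

lemma IsMinimizing.isTidyAbove [T2Space G] (h : IsMinimizing α U) : IsTidyAbove α U :=
  (isTidyAbove_iff_displacementIndex_minusTrunc_eq h.isCompact h.isOpen).mpr fun n => by
    rw [h.index_eq, (h.isMinimizing_minusTrunc n).index_eq]

lemma exists_lt_relIndex_minusTrunc_of_notMem_minus (hc : IsCompact (U : Set G))
    (ho : IsOpen (U : Set G)) (hx : x ∈ plus α U) (hx' : x ∈ minusMinus α U)
    (hxU : x ∉ minus α U) (C : ℕ) :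
    ∃ n, C < (minusTrunc α U n).relIndex (U.comap (iterHom α n) ⊓ U) := by
  obtain ⟨u, hu, huU⟩ := hx
  obtain ⟨N, hN⟩ := hx'
  obtain ⟨a, ha⟩ := not_forall.mp hxU
  have haN : a < N := not_le.mp fun h => ha (hN a h)
  let n := (C + 1) * N
  have hmul {i j : ℕ} (hij : i < j) : i * N + N ≤ j * N := by
    simpa only [Nat.succ_mul] using Nat.mul_le_mul_right N hij
  -- the points `u (i N)` of the trajectory leave `U` at the different times `a + i N`
  refine ⟨n, le_relIndex_of_forall_lt (fun i : Fin (C + 1) => u (i * N)) (fun i => ⟨?_, huU _⟩)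
    (fun i j hij hmem => ha ?_) ?_⟩
  · obtain ⟨k, hk⟩ := Nat.exists_eq_add_of_le' (hmul i.2)
    change α^[(C + 1) * N] (u (i * N)) ∈ U
    rw [hk, Nat.add_comm (i * N) N, ← Nat.add_assoc, Function.iterate_add_apply, hu.iterate_eq]
    exact hN _ (Nat.le_add_left N k)
  · obtain ⟨k, hk⟩ : ∃ k, (j : ℕ) * N = k + (a + i * N) :=
      Nat.exists_eq_add_of_le' (by have := hmul (Fin.lt_def.mp hij); omega)
    have hprod := hmem (a + i * N) <| (Nat.add_comm _ _).trans_le <|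
      (Nat.add_le_add_left haN.le _).trans (hmul i.2)
    rw [hk, iterate_mul, iterate_inv, Function.iterate_add_apply α a, hu.iterate_eq,
      hu.iterate] at hprod
    exact inv_mem_iff.mp ((Subgroup.mul_mem_cancel_right U (huU k)).mp hprod)
  · exact relIndex_ne_zero_of_isOpen_of_isCompact (isOpen_minusTrunc ho n)
      (hc.inter_left (Subgroup.isClosed_of_isOpen _ (ho.preimage (continuous_iterHom α n))))

lemma IsMinimizing.isTidy [T2Space G] (h : IsMinimizing α U) (hW : IsTidy α W) : IsTidy α U := by
  have hbound (n : ℕ) : (minusTrunc α U n).relIndex (U.comap (iterHom α n) ⊓ U) ≤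
      U.relIndex W * W.relIndex U := by
    refine Nat.le_of_mul_le_mul_right ?_
      (Nat.pos_of_ne_zero (relIndex_comap_iterHom_ne_zero (α := α) h.isOpen h.isCompact n))
    calc (minusTrunc α U n).relIndex (U.comap (iterHom α n) ⊓ U) *
          (U.comap (iterHom α n)).relIndex U
        = displacementIndex α W ^ n := by
          rw [Subgroup.relIndex_inf_mul_relIndex, inf_eq_left.mpr (minusTrunc_le_comap_iterHom n),
            h.isTidyAbove.relIndex_minusTrunc h.isCompact h.isOpen, h.index_eq,
            hW.isMinimizing.index_eq]
      _ ≤ U.relIndex W * W.relIndex U * (U.comap (iterHom α n)).relIndex U :=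
          hW.relIndex_comap_iterHom n ▸
            relIndex_comap_iterHom_le h.isCompact h.isOpen hW.isCompact hW.isOpen n
  refine ⟨h.isCompact, h.isOpen, h.isTidyAbove, h.isTidyAbove.inf_minusMinus_le fun z hz => ?_⟩
  by_contra hzU
  obtain ⟨n, hn⟩ := exists_lt_relIndex_minusTrunc_of_notMem_minus h.isCompact h.isOpen hz.1 hz.2
    hzU (U.relIndex W * W.relIndex U)
  exact hn.not_ge (hbound n)

end Scale

section CompactGroup

variable {P : Type*} [Group P]

lemma comap_eq_of_comap_le {φ : P →* P} {D : Subgroup P} (hφ : Function.Surjective φ)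
    (hD : D.index ≠ 0) (h : D.comap φ ≤ D) : D.comap φ = D := by
  have hindex := Subgroup.index_comap_of_surjective D hφ
  have : (D.comap φ).FiniteIndex := ⟨hindex ▸ hD⟩
  by_contra hne
  exact (Subgroup.index_strictAnti (lt_of_le_of_ne h hne)).ne' hindex

lemma comap_eq_of_le_comap {φ : P →* P} {D : Subgroup P} (hφ : Function.Surjective φ)
    (hD : D.index ≠ 0) (h : D ≤ D.comap φ) : D.comap φ = D := by
  have : D.FiniteIndex := ⟨hD⟩
  by_contra hne
  exact (Subgroup.index_strictAnti (lt_of_le_of_ne h (Ne.symm hne))).ne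
    (Subgroup.index_comap_of_surjective D hφ)

lemma exists_pos_forall_inv_mul_iterate_mem {φ : P →* P} {D : Subgroup P} [D.Normal]
    (hD : D.index ≠ 0) (h : D.comap φ = D) (x : P) : ∃ k > 0, ∀ n, x⁻¹ * φ^[k * n] x ∈ D := by
  have : Finite (P ⧸ D) := Nat.finite_of_card_ne_zero hD
  let f := QuotientGroup.map D D φ h.ge
  have hf : Function.Injective f := by
    rw [← MonoidHom.ker_eq_bot_iff, QuotientGroup.ker_map, h, QuotientGroup.map_mk'_self]
  obtain ⟨k, hk, hper⟩ := Function.mem_periodicPts.mp (hf.mem_periodicPts (x : P ⧸ D))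
  have hsemi : Function.Semiconj ((↑) : P → P ⧸ D) φ f := fun _ => rfl
  refine ⟨k, hk, fun n => QuotientGroup.eq.mp ?_⟩
  rw [(hsemi.iterate_right _).eq]
  exact (hper.mul_const n).eq.symm

variable [TopologicalSpace P] {φ : P →ₜ* P} {B D V W : Subgroup P}

lemma normal_minusTrunc [hB : B.Normal] (n : ℕ) : (minusTrunc φ B n).Normal :=
  ⟨fun x hx g k hk => by
    rw [iterate_mul, iterate_mul, iterate_inv]
    exact hB.conj_mem _ (hx k hk) _⟩

lemma normal_minusMinus [hB : B.Normal] : (minusMinus φ B).Normal :=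
  ⟨fun x ⟨m, hm⟩ g => ⟨m, fun k hk => by
    rw [iterate_mul, iterate_mul, iterate_inv]
    exact hB.conj_mem _ (hm k hk) _⟩⟩

lemma minusMinus_le_minus_of_comap_eq [D.Normal] (hD : D.index ≠ 0)
    (h : D.comap φ.toMonoidHom = D) (hDW : D ≤ W) : minusMinus φ W ≤ minus φ W := by
  rintro x ⟨m, hm⟩ j
  obtain ⟨k, hk, hper⟩ := exists_pos_forall_inv_mul_iterate_mem hD h (φ^[j] x)
  have hlate : φ^[k * m] (φ^[j] x) ∈ W := by
    rw [← Function.iterate_add_apply]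
    exact hm _ ((Nat.le_mul_of_pos_left m hk).trans (Nat.le_add_right _ _))
  exact inv_mem_iff.mp ((Subgroup.mul_mem_cancel_right W hlate).mp (hDW (hper m)))

variable [IsTopologicalGroup P] [CompactSpace P]

lemma index_ne_zero_of_isOpen (hD : IsOpen (D : Set P)) : D.index ≠ 0 := by
  have := Subgroup.quotient_finite_of_isOpen D hD
  exact Subgroup.finiteIndex_iff.mp Subgroup.finiteIndex_of_finite_quotient

lemma isOpen_normalCore (hD : IsOpen (D : Set P)) : IsOpen (D.normalCore : Set P) := by
  have : D.FiniteIndex := ⟨index_ne_zero_of_isOpen hD⟩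
  exact Subgroup.isOpen_of_isClosed_of_finiteIndex _
    (D.normalCore_isClosed (D.isClosed_of_isOpen hD))

lemma IsTidyAbove.comap_sup_plusPlus (hB : IsTidyAbove φ B) (hφ : Function.Surjective φ)
    (hBo : IsOpen (B : Set P)) :
    (B ⊔ plusPlus φ B).comap φ.toMonoidHom = B ⊔ plusPlus φ B := by
  refine comap_eq_of_le_comap hφ
    (index_ne_zero_of_isOpen (Subgroup.isOpen_mono le_sup_left hBo)) (sup_le (fun b hb => ?_) ?_)
  · obtain ⟨z, hz, v, hv, rfl⟩ := hB.exists_mul_eq hb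
    refine mul_mem ?_ (Subgroup.mem_sup_left (hv 1))
    exact Subgroup.mem_sup_right (isStable_plusPlus.le ⟨z, plus_le_plusPlus hz, rfl⟩)
  · exact (Subgroup.map_le_iff_le_comap.mp isStable_plusPlus.le).trans
      (Subgroup.comap_mono le_sup_right)

lemma IsTidyAbove.comap_sup_minusMinus [B.Normal] (hB : IsTidyAbove φ B)
    (hφ : Function.Surjective φ) (hBo : IsOpen (B : Set P)) :
    (B ⊔ minusMinus φ B).comap φ.toMonoidHom = B ⊔ minusMinus φ B := by
  refine comap_eq_of_comap_le hφ
    (index_ne_zero_of_isOpen (Subgroup.isOpen_mono le_sup_left hBo)) fun x hx => ?_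
  obtain ⟨_, hb, y, hy, hbx⟩ := Subgroup.mem_sup_of_normal_left.mp hx
  obtain ⟨_, hz, v, hv, rfl⟩ := hB.exists_mul_eq hb
  obtain ⟨z, hz', rfl⟩ := plus_le_map_plus hz
  have hzx : z⁻¹ * x ∈ minusMinus φ B := by
    rw [← comap_minusMinus, Subgroup.mem_comap, map_mul, map_inv, ← hbx, mul_assoc,
      inv_mul_cancel_left]
    exact mul_mem (minus_le_minusMinus hv) hy
  rw [← mul_inv_cancel_left z x]
  exact mul_mem (Subgroup.mem_sup_left (plus_le hz')) (Subgroup.mem_sup_right hzx)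

lemma IsTidyAbove.minusMinus_le_sup_homoclinic [B.Normal] (hB : IsTidyAbove φ B)
    (hφ : Function.Surjective φ) (hBo : IsOpen (B : Set P)) :
    minusMinus φ B ≤ B ⊔ homoclinic φ B := by
  rintro y ⟨m, hm⟩
  have hy : y ∈ B ⊔ plusPlus φ B := (iterate_mem_iff (hB.comap_sup_plusPlus hφ hBo) m).mp
    (Subgroup.mem_sup_left (hm m le_rfl))
  obtain ⟨c, hc, p, hp, rfl⟩ := Subgroup.mem_sup_of_normal_left.mp hy
  obtain ⟨z, hz, v, hv, hzv⟩ := hB.exists_mul_eq (inv_mem hc)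
  have hvzp : c * p = v⁻¹ * (z⁻¹ * p) := by rw [← mul_assoc, ← mul_inv_rev, hzv, inv_inv]
  have hzp : z⁻¹ * p ∈ minusMinus φ B :=
    (Subgroup.mul_mem_cancel_left _ (Subgroup.inv_mem _ (minus_le_minusMinus hv))).mp
      (hvzp ▸ ⟨m, hm⟩)
  rw [hvzp]
  exact mul_mem (Subgroup.mem_sup_left (inv_mem (minus_le hv)))
    (Subgroup.mem_sup_right
      ⟨Subgroup.mul_mem _ (Subgroup.inv_mem _ (plus_le_plusPlus hz)) hp, hzp⟩)

lemma exists_normal_comap_eq_le_sup_homoclinic [T2Space P] (hφ : Function.Surjective φ)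
    (hV : IsOpen (V : Set P)) :
    ∃ D : Subgroup P, D.Normal ∧ D.index ≠ 0 ∧ D.comap φ.toMonoidHom = D ∧
      D ≤ V ⊔ homoclinic φ V := by
  have hNo := isOpen_normalCore hV
  obtain ⟨n, hB⟩ := exists_isTidyAbove_minusTrunc (α := φ)
    (Subgroup.isClosed_of_isOpen _ hNo).isCompact hNo
  set B := minusTrunc φ V.normalCore n
  have hBo : IsOpen (B : Set P) := isOpen_minusTrunc hNo n
  have hBV : B ≤ V := (minusTrunc_le n).trans V.normalCore_le
  have : B.Normal := normal_minusTrunc n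
  have : (minusMinus φ B).Normal := normal_minusMinus
  refine ⟨B ⊔ minusMinus φ B, inferInstance,
    index_ne_zero_of_isOpen (Subgroup.isOpen_mono le_sup_left hBo),
    hB.comap_sup_minusMinus hφ hBo, ?_⟩
  exact sup_le (hBV.trans le_sup_left)
    ((hB.minusMinus_le_sup_homoclinic hφ hBo).trans (sup_le_sup hBV (homoclinic_mono hBV)))

lemma minusMinus_le_minus_of_homoclinic_le [T2Space P] (hφ : Function.Surjective φ)
    (hV : IsOpen (V : Set P)) (hW : IsOpen (W : Set P)) (hVW : homoclinic φ V ≤ W) :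
    minusMinus φ W ≤ minus φ W := by
  obtain ⟨D, hDn, hDi, hDφ, hD⟩ := exists_normal_comap_eq_le_sup_homoclinic (V := V ⊓ W) hφ
    (hV.inter hW)
  exact minusMinus_le_minus_of_comap_eq hDi hDφ
    (hD.trans (sup_le inf_le_right ((homoclinic_mono inf_le_left).trans hVW)))

end CompactGroup

section Restriction

variable {G : Type*} [Group G] [TopologicalSpace G]

/-- The restriction of `α` to a subgroup `P` that it maps into itself. -/
def restrictHom (α : G →ₜ* G) (P : Subgroup G) (hP : IsInvariant α P) : P →ₜ* P where
  toMonoidHom := (α.toMonoidHom.comp P.subtype).codRestrict P fun x => hP ⟨x, x.2, rfl⟩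
  continuous_toFun := ((map_continuous α).comp continuous_subtype_val).subtype_mk _

variable {α : G →ₜ* G} {P V : Subgroup G}

lemma coe_restrictHom_iterate (hP : IsInvariant α P) (n : ℕ) (x : P) :
    (((restrictHom α P hP)^[n] x : P) : G) = α^[n] x :=
  (show Function.Semiconj ((↑) : P → G) (restrictHom α P hP) α from fun _ => rfl).iterate_right n x

lemma minus_restrictHom (hP : IsInvariant α P) :
    minus (restrictHom α P hP) (V.subgroupOf P) = (minus α V).subgroupOf P := by
  ext x
  exact forall_congr' fun k => coe_restrictHom_iterate hP k x ▸ Iff.rfl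

lemma minusMinus_restrictHom (hP : IsInvariant α P) :
    minusMinus (restrictHom α P hP) (V.subgroupOf P) = (minusMinus α V).subgroupOf P := by
  ext x
  exact exists_congr fun m => forall₂_congr fun k _ => coe_restrictHom_iterate hP k x ▸ Iff.rfl

lemma homoclinic_restrictHom_le (hP : IsInvariant α P) :
    homoclinic (restrictHom α P hP) (V.subgroupOf P) ≤ (homoclinic α V).subgroupOf P := by
  rintro x ⟨⟨u, hu, huV⟩, hx⟩
  refine ⟨⟨fun k => u k, ⟨congrArg Subtype.val hu.zero, fun k => ?_⟩, huV⟩, ?_⟩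
  · exact congrArg Subtype.val (hu.succ k)
  · exact (minusMinus_restrictHom hP).le hx

lemma IsStable.isInvariant (h : IsStable α P) : IsInvariant α P := h.le

lemma IsStable.surjective_restrictHom (h : IsStable α P) :
    Function.Surjective (restrictHom α P h.isInvariant) := by
  rintro ⟨y, hy⟩
  obtain ⟨x, hx, rfl⟩ := h.ge hy
  exact ⟨⟨x, hx⟩, rfl⟩

end Restriction

section Tidying

variable {G : Type*} [Group G] [TopologicalSpace G] [IsTopologicalGroup G]
  {α : G →ₜ* G} {O V W : Subgroup G}

lemma isStable_topologicalClosure_homoclinic [T2Space G] (hc : IsCompact (V : Set G))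
    (ho : IsOpen (V : Set G)) : IsStable α (homoclinic α V).topologicalClosure :=
  isStable_homoclinic.topologicalClosure (isCompact_topologicalClosure_homoclinic hc ho)

lemma IsTidyAbove.isTidy_of_homoclinic_le [T2Space G] (h : IsTidyAbove α W)
    (hc : IsCompact (W : Set G)) (ho : IsOpen (W : Set G)) (hVo : IsOpen (V : Set G))
    (hVW : homoclinic α V ≤ W) : IsTidy α W := by
  refine ⟨hc, ho, h, h.inf_minusMinus_le fun z hz => ?_⟩
  let P := (homoclinic α W).topologicalClosure
  have hP : IsStable α P := isStable_topologicalClosure_homoclinic hc ho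
  have : CompactSpace P :=
    isCompact_iff_compactSpace.mp (isCompact_topologicalClosure_homoclinic hc ho)
  have hle : minusMinus (restrictHom α P hP.isInvariant) (W.subgroupOf P) ≤
      minus (restrictHom α P hP.isInvariant) (W.subgroupOf P) :=
    minusMinus_le_minus_of_homoclinic_le hP.surjective_restrictHom (V := V.subgroupOf P)
      (hVo.preimage continuous_subtype_val) (ho.preimage continuous_subtype_val)
      ((homoclinic_restrictHom_le hP.isInvariant).trans (Subgroup.comap_mono hVW))
  rw [minusMinus_restrictHom, minus_restrictHom] at hle
  have hzP : z ∈ P := Subgroup.le_topologicalClosure _ ⟨plus_le_plusPlus hz.1, hz.2⟩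
  exact hle (x := ⟨z, hzP⟩) hz.2

lemma exists_isTidy_le [T2Space G] (hVc : IsCompact (V : Set G)) (hVo : IsOpen (V : Set G))
    (hc : IsCompact (O : Set G)) (ho : IsOpen (O : Set G))
    (hVO : (homoclinic α V).topologicalClosure ≤ O) : ∃ W ≤ O, IsTidy α W := by
  obtain ⟨n, hn⟩ := exists_isTidyAbove_minusTrunc (α := α) hc ho
  refine ⟨_, minusTrunc_le n, hn.isTidy_of_homoclinic_le (isCompact_minusTrunc hc n)
    (isOpen_minusTrunc ho n) hVo ?_⟩
  exact (Subgroup.le_topologicalClosure _).trans ((le_minus_of_map_le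
    (isStable_topologicalClosure_homoclinic hVc hVo).le hVO).trans (minus_le_minusTrunc n))

variable [LocallyCompactSpace G] [TotallyDisconnectedSpace G]

lemma exists_isTidy (α : G →ₜ* G) : ∃ W, IsTidy α W := by
  obtain ⟨V, hVc, hVo, -⟩ := exists_isCompact_isOpen_subgroup_subset (G := G) Filter.univ_mem
  obtain ⟨O, hOc, hOo, hVO, -⟩ := exists_isCompact_isOpen_le_and_subset_mul
    (isCompact_topologicalClosure_homoclinic (α := α) hVc hVo) hVc hVo
  obtain ⟨W, -, hW⟩ := exists_isTidy_le hVc hVo hOc hOo hVO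
  exact ⟨W, hW⟩

lemma isMinimizing_iff_isTidy : IsMinimizing α W ↔ IsTidy α W :=
  ⟨fun h => h.isTidy (exists_isTidy α).choose_spec, IsTidy.isMinimizing⟩

lemma nub_le_topologicalClosure_homoclinic (hVc : IsCompact (V : Set G))
    (hVo : IsOpen (V : Set G)) : nub α ≤ (homoclinic α V).topologicalClosure := fun _ hx =>
  mem_of_forall_mem_isCompact_isOpen (isCompact_topologicalClosure_homoclinic hVc hVo)
    fun _ hOc hOo hVO =>
      let ⟨W, hWO, hW⟩ := exists_isTidy_le hVc hVo hOc hOo hVO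
      hWO (Subgroup.mem_sInf.mp hx W hW.isMinimizing)

end Tidying

section Parabolic

variable {G : Type*} [Group G] [TopologicalSpace G] {α : G →ₜ* G} {H U : Subgroup G} {u : ℕ → G}
  {C : Set G}

lemma comap_iteratedKernel (α : G →ₜ* G) :
    (iteratedKernel α).comap α.toMonoidHom = iteratedKernel α := by
  ext x
  refine ⟨fun ⟨n, hn⟩ => ⟨n + 1, hn⟩, fun ⟨n, hn⟩ => ⟨n, ?_⟩⟩
  change α^[n + 1] x = 1
  rw [Function.iterate_succ_apply', hn, map_one]

lemma normal_iteratedKernel (α : G →ₜ* G) : (iteratedKernel α).Normal :=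
  ⟨fun x ⟨n, hn⟩ g => ⟨n, by
    rw [iterate_mul, iterate_mul, iterate_inv, hn, mul_one, mul_inv_cancel]⟩⟩

lemma iteratedKernel_le_minusMinus : iteratedKernel α ≤ minusMinus α U := fun _ ⟨n, hn⟩ =>
  (iterate_mem_iff comap_minusMinus n).mp (hn ▸ one_mem _)

lemma IsTidy.exists_forall_iterate_mem_minus (h : IsTidy α U) (hC : IsCompact C)
    (hCU : C ⊆ minusMinus α U) : ∃ m, ∀ c ∈ C, α^[m] c ∈ minus α U := by
  obtain ⟨F, hF⟩ := hC.elim_finite_subcover (fun n : ℕ => α^[n] ⁻¹' (U : Set G))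
    (fun n => h.isOpen.preimage (continuous_iterHom α n))
    fun c hc => let ⟨n, hn⟩ := hCU hc; Set.mem_iUnion.mpr ⟨n, hn n le_rfl⟩
  obtain ⟨m, hm⟩ := F.bddAbove
  refine ⟨m, fun c hc => iterate_mem_minus_of_forall_ge fun k hk => ?_⟩
  obtain ⟨n, hn, hnU⟩ := Set.mem_iUnion₂.mp (hF hc)
  have hn' : α^[n] c ∈ minus α U :=
    h.inf_minusMinus_le ⟨hnU, (iterate_mem_iff comap_minusMinus n).mpr (hCU hc)⟩
  obtain ⟨j, rfl⟩ := Nat.exists_eq_add_of_le' ((hm hn).trans hk)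
  exact (Function.iterate_add_apply α j n c).symm ▸ hn' j

variable [IsTopologicalGroup G]

lemma IsBoundedSeq.of_forall_mem (hC : IsCompact C) (h : ∀ n, u n ∈ C) : IsBoundedSeq u :=
  hC.closure_of_subset (Set.range_subset_iff.mpr h)

lemma IsBoundedSeq.shift (hu : IsBoundedSeq u) (m : ℕ) : IsBoundedSeq fun n => u (m + n) :=
  .of_forall_mem hu fun n => subset_closure ⟨m + n, rfl⟩

lemma IsBoundedSeq.of_shift {m : ℕ} (hu : IsBoundedSeq fun n => u (m + n)) : IsBoundedSeq u := by
  refine .of_forall_mem (hu.union ((Set.finite_lt_nat m).image u).isCompact) fun n => ?_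
  rcases lt_or_ge n m with h | h
  · exact Or.inr ⟨n, h, rfl⟩
  · exact Or.inl (subset_closure ⟨n - m, congrArg u (Nat.add_sub_of_le h)⟩)

lemma comap_parPlus (α : G →ₜ* G) : (parPlus α).comap α.toMonoidHom = parPlus α := by
  ext x
  have hshift : (fun n => α^[n] (α x)) = fun n => α^[1 + n] x := by
    simp only [Nat.add_comm 1, Function.iterate_succ_apply]
  change IsBoundedSeq (fun n => α^[n] (α x)) ↔ IsBoundedSeq (fun n => α^[n] x)
  rw [hshift]
  exact ⟨.of_shift (u := fun n => α^[n] x), fun h => h.shift 1⟩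

lemma isStable_parMinus (α : G →ₜ* G) : IsStable α (parMinus α) := by
  apply le_antisymm
  · rintro _ ⟨x, hx, rfl⟩
    exact map_mem_parMinus α hx
  · rintro x ⟨u, hu, hub⟩
    exact ⟨u 1, ⟨_, hu.shift 1, hub.shift 1⟩, hu.iterate_eq 1⟩

lemma isStable_lev (α : G →ₜ* G) : IsStable α (lev α) := by
  rw [lev, inf_comm]
  exact (isStable_parMinus α).inf (comap_parPlus α)

lemma isStable_iteratedKernel_inf_parMinus (α : G →ₜ* G) :
    IsStable α (iteratedKernel α ⊓ parMinus α) := by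
  rw [inf_comm]
  exact (isStable_parMinus α).inf (comap_iteratedKernel α)

lemma isInvariant_topologicalClosure_iteratedKernel_inf_parMinus (α : G →ₜ* G) :
    IsInvariant α ((iteratedKernel α).topologicalClosure ⊓ parMinus α) :=
  (Subgroup.map_inf_le _ _ _).trans (inf_le_inf
    (map_topologicalClosure_le (Subgroup.map_le_iff_le_comap.mpr (comap_iteratedKernel α).ge))
    (isStable_parMinus α).le)

lemma normal_subgroupOf_topologicalClosure_iteratedKernel_inf_parMinus (α : G →ₜ* G) :
    (((iteratedKernel α).topologicalClosure ⊓ parMinus α).subgroupOf (parMinus α)).Normal := by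
  have := normal_iteratedKernel α
  have := Subgroup.is_normal_topologicalClosure (iteratedKernel α)
  rw [Subgroup.inf_subgroupOf_right]
  infer_instance

lemma ikInParMinus_eq_topologicalClosure (α : G →ₜ* G) :
    ikInParMinus α = ((iteratedKernel α).subgroupOf (parMinus α)).topologicalClosure := by
  refine SetLike.coe_injective ?_
  rw [Subgroup.topologicalClosure_coe, IsInducing.subtypeVal.closure_eq_preimage_closure_image]
  change Subtype.val ⁻¹' closure _ = _
  rw [← Subgroup.subgroupOf_map_subtype]
  rfl

lemma normal_ikInParMinus (α : G →ₜ* G) : (ikInParMinus α).Normal := by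
  have := normal_iteratedKernel α
  rw [ikInParMinus_eq_topologicalClosure]
  exact Subgroup.is_normal_topologicalClosure _

lemma plusPlus_le_parMinus (hc : IsCompact (U : Set G)) : plusPlus α U ≤ parMinus α :=
  fun _ ⟨u, hu, m, hm⟩ =>
    ⟨u, hu, .of_shift (m := m) (.of_forall_mem hc fun n => hm _ (Nat.le_add_right m n))⟩

lemma plus_le_parMinus (hc : IsCompact (U : Set G)) : plus α U ≤ parMinus α :=
  plus_le_plusPlus.trans (plusPlus_le_parMinus hc)

lemma minus_le_parPlus (hc : IsCompact (U : Set G)) : minus α U ≤ parPlus α :=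
  fun _ hx => .of_forall_mem hc hx

lemma le_lev_of_isStable (hc : IsCompact (H : Set G)) (hH : IsStable α H) : H ≤ lev α :=
  le_inf ((le_minus_of_map_le hH.le le_rfl).trans (minus_le_parPlus hc))
    ((le_plus_of_le_map hH.ge le_rfl).trans (plus_le_parMinus hc))

lemma IsTidy.isClosed_minusMinus (h : IsTidy α U) : IsClosed (minusMinus α U : Set G) := by
  refine isClosed_of_closure_subset fun x hx => ?_
  obtain ⟨_, ⟨g, hg, rfl⟩, hxg⟩ := mem_closure_iff_nhds.mp hx (x • (U : Set G))
    ((h.isOpen.smul x).mem_nhds ⟨1, U.one_mem, mul_one x⟩)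
  have hg' : g ∈ (minusMinus α U).topologicalClosure :=
    (Subgroup.mul_mem_cancel_left _ hx).mp ((minusMinus α U).le_topologicalClosure hxg)
  have hgU : g ∈ minus α U := closure_minimal h.inf_minusMinus_le
    (isClosed_minus (Subgroup.isClosed_of_isOpen _ h.isOpen)) (h.isOpen.inter_closure ⟨hg, hg'⟩)
  exact (Subgroup.mul_mem_cancel_right _ (minus_le_minusMinus hgU)).mp hxg

lemma IsTidy.parMinus_inf_minusMinus_le (h : IsTidy α U) :
    parMinus α ⊓ minusMinus α U ≤ plus α (minus α U) := by
  rintro x ⟨⟨u, hu, hub⟩, hxU⟩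
  have huU : Set.range u ⊆ minusMinus α U := Set.range_subset_iff.mpr fun n =>
    (iterate_mem_iff comap_minusMinus n).mp ((hu.iterate_eq n).symm ▸ hxU)
  obtain ⟨m, hm⟩ :=
    h.exists_forall_iterate_mem_minus hub (closure_minimal huU h.isClosed_minusMinus)
  exact ⟨u, hu, fun n => hu.iterate n m ▸ hm _ (subset_closure ⟨n + m, rfl⟩)⟩

lemma IsTidy.inf_parMinus (h : IsTidy α U) : U ⊓ parMinus α = plus α U := by
  refine le_antisymm ?_ (le_inf plus_le (plus_le_parMinus h.isCompact))
  rintro x ⟨hxU, hx⟩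
  obtain ⟨z, hz, v, hv, rfl⟩ := h.isTidyAbove.exists_mul_eq hxU
  have hv' : v ∈ parMinus α :=
    (Subgroup.mul_mem_cancel_left _ (plus_le_parMinus h.isCompact hz)).mp hx
  exact mul_mem hz (le_plus_of_le_map plus_le_map_plus (plus_le.trans minus_le)
    (h.parMinus_inf_minusMinus_le ⟨hv', minus_le_minusMinus hv⟩))

lemma IsTidy.topologicalClosure_homoclinic_le (h : IsTidy α U) :
    (homoclinic α U).topologicalClosure ≤ U :=
  Subgroup.topologicalClosure_minimal _
    ((inf_le_inf_right _ (plusPlus_le_parMinus h.isCompact)).trans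
      (h.parMinus_inf_minusMinus_le.trans (plus_le.trans minus_le)))
    (Subgroup.isClosed_of_isOpen _ h.isOpen)

lemma IsTidy.topologicalClosure_iteratedKernel_inf_parMinus_le (h : IsTidy α U) :
    (iteratedKernel α).topologicalClosure ⊓ parMinus α ≤ U := by
  have hle : (iteratedKernel α).topologicalClosure ≤ minusMinus α U :=
    Subgroup.topologicalClosure_minimal _ iteratedKernel_le_minusMinus h.isClosed_minusMinus
  exact inf_comm (parMinus α) _ ▸ (inf_le_inf_left _ hle).trans
    (h.parMinus_inf_minusMinus_le.trans (plus_le.trans minus_le))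

end Parabolic

section Nub

variable {G : Type*} [Group G] [TopologicalSpace G] [IsTopologicalGroup G]
  [LocallyCompactSpace G] [TotallyDisconnectedSpace G]

lemma isCompact_nub (α : G →ₜ* G) : IsCompact (nub α : Set G) := by
  obtain ⟨W, hW⟩ := exists_isTidy α
  refine hW.isCompact.of_isClosed_subset ?_ (show nub α ≤ W from sInf_le hW.isMinimizing)
  rw [nub, Subgroup.coe_sInf]
  exact isClosed_biInter fun V hV => Subgroup.isClosed_of_isOpen _ hV.isOpen

lemma nub_eq_iInf_topologicalClosure_homoclinic (α : G →ₜ* G) :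
    nub α = ⨅ V : {V : Subgroup G // IsCompact (V : Set G) ∧ IsOpen (V : Set G)},
      (homoclinic α V.1).topologicalClosure :=
  le_antisymm (le_iInf fun V => nub_le_topologicalClosure_homoclinic V.2.1 V.2.2)
    (le_sInf fun W (hW : IsMinimizing α W) => iInf_le_of_le ⟨W, hW.isCompact, hW.isOpen⟩
      (isMinimizing_iff_isTidy.mp hW).topologicalClosure_homoclinic_le)

lemma isStable_nub (α : G →ₜ* G) : IsStable α (nub α) := by
  obtain ⟨W, hW⟩ := exists_isTidy α
  have : Nonempty {V : Subgroup G // IsCompact (V : Set G) ∧ IsOpen (V : Set G)} :=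
    ⟨⟨W, hW.isCompact, hW.isOpen⟩⟩
  refine SetLike.coe_injective ?_
  rw [nub_eq_iInf_topologicalClosure_homoclinic, Subgroup.coe_map, Subgroup.coe_iInf]
  refine (image_iInter_of_directed_isCompact (map_continuous α) (fun V₁ V₂ => ?_)
    fun V => isCompact_topologicalClosure_homoclinic V.2.1 V.2.2).trans
    (Set.iInter_congr fun V => congrArg SetLike.coe
      (isStable_topologicalClosure_homoclinic V.2.1 V.2.2))
  exact ⟨⟨V₁.1 ⊓ V₂.1, V₁.2.1.inter_right (Subgroup.isClosed_of_isOpen _ V₂.2.2),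
    V₁.2.2.inter V₂.2.2⟩, Subgroup.topologicalClosure_mono (homoclinic_mono inf_le_left),
    Subgroup.topologicalClosure_mono (homoclinic_mono inf_le_right)⟩

lemma nub_le_lev (α : G →ₜ* G) : nub α ≤ lev α :=
  le_lev_of_isStable (isCompact_nub α) (isStable_nub α)

lemma nub_le_parMinus (α : G →ₜ* G) : nub α ≤ parMinus α := (nub_le_lev α).trans inf_le_right

lemma topologicalClosure_iteratedKernel_inf_parMinus_le_nub (α : G →ₜ* G) :
    (iteratedKernel α).topologicalClosure ⊓ parMinus α ≤ nub α := le_sInf fun _ hW =>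
  (isMinimizing_iff_isTidy.mp hW).topologicalClosure_iteratedKernel_inf_parMinus_le

lemma isCompact_topologicalClosure_iteratedKernel_inf_parMinus (α : G →ₜ* G) :
    IsCompact (((iteratedKernel α).topologicalClosure ⊓ parMinus α : Subgroup G) : Set G) := by
  have hnub : (iteratedKernel α).topologicalClosure ⊓ parMinus α =
      (iteratedKernel α).topologicalClosure ⊓ nub α :=
    le_antisymm (le_inf inf_le_left (topologicalClosure_iteratedKernel_inf_parMinus_le_nub α))
      (inf_le_inf_left _ (nub_le_parMinus α))
  rw [hnub]
  exact (isCompact_nub α).inter_left (Subgroup.isClosed_topologicalClosure _)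

lemma ik_le_nub (α : G →ₜ* G) : ik α ≤ nub α :=
  Subgroup.topologicalClosure_minimal _
    ((inf_le_inf_right _ (Subgroup.le_topologicalClosure _)).trans
      (topologicalClosure_iteratedKernel_inf_parMinus_le_nub α)) (isCompact_nub α).isClosed

lemma ik_le_parMinus (α : G →ₜ* G) : ik α ≤ parMinus α :=
  (ik_le_nub α).trans (nub_le_parMinus α)

lemma ik_le_topologicalClosure_inf_parMinus (α : G →ₜ* G) :
    ik α ≤ (iteratedKernel α).topologicalClosure ⊓ parMinus α :=
  le_inf (Subgroup.topologicalClosure_mono inf_le_left) (ik_le_parMinus α)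

lemma isCompact_ik (α : G →ₜ* G) : IsCompact (ik α : Set G) :=
  (isCompact_nub α).of_isClosed_subset (Subgroup.isClosed_topologicalClosure _) (ik_le_nub α)

lemma isStable_ik (α : G →ₜ* G) : IsStable α (ik α) :=
  (isStable_iteratedKernel_inf_parMinus α).topologicalClosure (isCompact_ik α)

end Nub

section Quotient

lemma image_mem_nhds_one_of_ker_subset {P Q : Type*} [Group P] [TopologicalSpace P] [Group Q]
    [TopologicalSpace Q] [T2Space Q] {f : P →* Q} (hf : Continuous f) {A T : Set P}
    (hA : IsCompact A) (hfA : f '' A ∈ 𝓝 1) (hT : IsOpen T) (hker : (f.ker : Set P) ⊆ T) :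
    f '' T ∈ 𝓝 1 := by
  have hclosed : IsClosed (f '' (A \ T)) := ((hA.diff hT).image hf).isClosed
  have hone : 1 ∉ f '' (A \ T) := fun ⟨_, hx, hfx⟩ => hx.2 (hker hfx)
  filter_upwards [hfA, hclosed.isOpen_compl.mem_nhds hone]
  rintro _ ⟨x, hx, rfl⟩ hx'
  exact ⟨x, by_contra fun hxT => hx' ⟨x, ⟨hx, hxT⟩, rfl⟩, rfl⟩

lemma isHomeomorph_quotientGroupMap {P Q : Type*} [Group P] [TopologicalSpace P]
    [IsTopologicalGroup P] [Group Q] [TopologicalSpace Q] [IsTopologicalGroup Q] {M : Subgroup P}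
    {N : Subgroup Q} [M.Normal] [N.Normal] {f : P →* Q} (hf : Continuous f)
    (hsurj : Function.Surjective f) (h : N.comap f = M)
    (hopen : ∀ T : Set P, IsOpen T → (M : Set P) ⊆ T → f '' T ∈ 𝓝 1) :
    IsHomeomorph (QuotientGroup.map M N f h.ge) := by
  refine ⟨?_, IsTopologicalGroup.isOpenMap_iff_nhds_one.mpr fun S hS => ?_, ?_, ?_⟩
  · exact (QuotientGroup.continuous_mk.comp hf).quotient_lift _
  · obtain ⟨T, hTS, hT, hT₁⟩ := mem_nhds_iff.mp (Filter.mem_map.mp hS)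
    have hMT : (M : Set P) ⊆ QuotientGroup.mk ⁻¹' T := fun x hx => by
      rwa [Set.mem_preimage, (QuotientGroup.eq_one_iff x).mpr hx]
    refine Filter.mem_of_superset (QuotientGroup.isOpenMap_coe.image_mem_nhds
      (hopen _ (hT.preimage QuotientGroup.continuous_mk) hMT)) ?_
    rintro _ ⟨_, ⟨x, hx, rfl⟩, rfl⟩
    exact hTS hx
  · rw [← MonoidHom.ker_eq_bot_iff, QuotientGroup.ker_map, h, QuotientGroup.map_mk'_self]
  · exact QuotientGroup.map_surjective_of_surjective _ _ _
      ((QuotientGroup.mk'_surjective N).comp hsurj) _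

variable {G : Type*} [Group G] [TopologicalSpace G] [IsTopologicalGroup G]

lemma continuous_parMinusHom (α : G →ₜ* G) : Continuous (parMinusHom α) :=
  ((map_continuous α).comp continuous_subtype_val).subtype_mk _

lemma surjective_parMinusHom (α : G →ₜ* G) : Function.Surjective (parMinusHom α) := fun y =>
  let ⟨x, hx, hxy⟩ := (isStable_parMinus α).ge y.2
  ⟨⟨x, hx⟩, Subtype.ext hxy⟩

lemma ker_parMinusHom_le (α : G →ₜ* G) : (parMinusHom α).ker ≤ ikInParMinus α := fun x hx =>
  Subgroup.le_topologicalClosure _ ⟨⟨1, congrArg Subtype.val hx⟩, x.2⟩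

variable [LocallyCompactSpace G] [TotallyDisconnectedSpace G]

lemma map_ikInParMinus (α : G →ₜ* G) :
    (ikInParMinus α).map (parMinusHom α) = ikInParMinus α := by
  apply le_antisymm
  · rintro _ ⟨x, hx, rfl⟩
    exact (isStable_ik α).le ⟨x, hx, rfl⟩
  · intro x hx
    obtain ⟨y, hy, hyx⟩ := (isStable_ik α).ge hx
    exact ⟨⟨y, ik_le_parMinus α hy⟩, hy, Subtype.ext hyx⟩

lemma comap_ikInParMinus (α : G →ₜ* G) :
    (ikInParMinus α).comap (parMinusHom α) = ikInParMinus α := by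
  conv_lhs => rw [← map_ikInParMinus]
  exact Subgroup.comap_map_eq_self (ker_parMinusHom_le α)

lemma exists_isCompact_image_parMinusHom_mem_nhds_one (α : G →ₜ* G) :
    ∃ A : Set (parMinus α), IsCompact A ∧ parMinusHom α '' A ∈ 𝓝 1 := by
  obtain ⟨U, hU⟩ := exists_isTidy α
  have hplus := plus_le_parMinus (α := α) hU.isCompact
  have hUplus : (plus α U).subgroupOf (parMinus α) = U.subgroupOf (parMinus α) := by
    rw [← hU.inf_parMinus, Subgroup.inf_subgroupOf_right]
  have hnhds : (U.subgroupOf (parMinus α) : Set (parMinus α)) ∈ 𝓝 1 :=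
    (hU.isOpen.preimage continuous_subtype_val).mem_nhds (one_mem U)
  refine ⟨(plus α U).subgroupOf (parMinus α), ?_, Filter.mem_of_superset hnhds ?_⟩
  · exact IsInducing.subtypeVal.isCompact_preimage' (isCompact_plus hU.isCompact)
      (Subtype.range_coe ▸ hplus)
  · rw [← hUplus]
    intro x hx
    obtain ⟨y, hy, hyx⟩ := plus_le_map_plus hx
    exact ⟨⟨y, hplus hy⟩, hy, Subtype.ext hyx⟩

lemma isHomeomorph_quotientMap_parMinusHom (α : G →ₜ* G) [(ikInParMinus α).Normal] :
    IsHomeomorph (QuotientGroup.map (ikInParMinus α) (ikInParMinus α) (parMinusHom α)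
      (comap_ikInParMinus α).ge) := by
  obtain ⟨A, hA, hαA⟩ := exists_isCompact_image_parMinusHom_mem_nhds_one α
  exact isHomeomorph_quotientGroupMap (continuous_parMinusHom α) (surjective_parMinusHom α)
    (comap_ikInParMinus α) fun T hT hikT => image_mem_nhds_one_of_ker_subset
      (continuous_parMinusHom α) hA hαA hT
        (Set.Subset.trans (ker_parMinusHom_le α) hikT)

end Quotient

end Endo

theorem mainTheorem9 {G : Type*} [Group G] [TopologicalSpace G] [IsTopologicalGroup G]
    [LocallyCompactSpace G] [TotallyDisconnectedSpace G] (α : G →ₜ* G) :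
    -- the chain of inclusions
    (Endo.ik α ≤ Endo.nub α ∧ Endo.nub α ≤ Endo.lev α) ∧
    -- stability
    (Endo.IsStable α (Endo.ik α) ∧ Endo.IsStable α (Endo.nub α) ∧
      Endo.IsStable α (Endo.lev α)) ∧
    -- compactness
    (IsCompact (Endo.nub α : Set G) ∧ IsCompact (Endo.ik α : Set G)) ∧
    -- normality in the anti-parabolic subgroup; the induced map on the quotient is
    -- an isomorphism of topological groups
    (Endo.ik α ≤ Endo.parMinus α ∧
      ∃ (_ : (Endo.ikInParMinus α).Normal)
        (h : Endo.ikInParMinus α ≤ (Endo.ikInParMinus α).comap (Endo.parMinusHom α)),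
        IsHomeomorph (QuotientGroup.map (Endo.ikInParMinus α) (Endo.ikInParMinus α)
          (Endo.parMinusHom α) h)) ∧
    -- the subgroup obtained by taking the closure before intersecting with the
    -- anti-parabolic subgroup
    (Endo.ik α ≤ (Endo.iteratedKernel α).topologicalClosure ⊓ Endo.parMinus α ∧
      (Endo.iteratedKernel α).topologicalClosure ⊓ Endo.parMinus α ≤ Endo.nub α ∧
      Endo.IsInvariant α ((Endo.iteratedKernel α).topologicalClosure ⊓ Endo.parMinus α) ∧
      IsCompact (((Endo.iteratedKernel α).topologicalClosure ⊓ Endo.parMinus α : Subgroup G) :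
        Set G) ∧
      (((Endo.iteratedKernel α).topologicalClosure ⊓ Endo.parMinus α).subgroupOf
        (Endo.parMinus α)).Normal) := by
  have := Endo.normal_ikInParMinus α
  exact ⟨⟨Endo.ik_le_nub α, Endo.nub_le_lev α⟩,
    ⟨Endo.isStable_ik α, Endo.isStable_nub α, Endo.isStable_lev α⟩,
    ⟨Endo.isCompact_nub α, Endo.isCompact_ik α⟩,
    ⟨Endo.ik_le_parMinus α, Endo.normal_ikInParMinus α, (Endo.comap_ikInParMinus α).ge,
      Endo.isHomeomorph_quotientMap_parMinusHom α⟩,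
    Endo.ik_le_topologicalClosure_inf_parMinus α,
    Endo.topologicalClosure_iteratedKernel_inf_parMinus_le_nub α,
    Endo.isInvariant_topologicalClosure_iteratedKernel_inf_parMinus α,
    Endo.isCompact_topologicalClosure_iteratedKernel_inf_parMinus α,
    Endo.normal_subgroupOf_topologicalClosure_iteratedKernel_inf_parMinus α⟩
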